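/- **Setting.** Let $\mathcal{A}\subset\mathbb{R}^d$ be finite, $\mathcal{Y}$ a measurable space of outcomes (for instance a subset of a Euclidean space), $R:\mathcal{Y}\to\mathbb{R}$ a measurable reward function with $\sup R-\inf R\le 1$, and $\mathcal{P}$ a family of probability distributions on $\mathcal{Y}^{\mathcal{A}}$; for $p\in\mathcal P$ let $p_a$ be the marginal of the coordinate $a$. On a probability space, let $p^*$ be a random element of $\mathcal{P}$ and let $Y_t=(Y_{t,a})_{a\in\mathcal{A}}$, $t\ge 1$, be i.i.d. with law $p^*$ conditionally on $p^*$. Let $A^*$ be an optimal action, that is, a measurable function of $p^*$ with $A^*\in\arg\max_{a\in\mathcal{A}}\mathbb{E}_{y\sim p^*_a}[R(y)]$ almost surely. Let $(U_t)_{t\ge1}$ be random variables such that each $U_i$ is independent of the collection formed by $(U_t)_{t\ne i}$, $(Y_t)_{t\ge1}$ and $p^*$. Let $\mathcal{F}_t$ be the $\sigma$-algebra generated by $A_1,Y_{1,A_1},\dots,A_{t-1},Y_{t-1,A_{t-1}}$, where the action $A_t\in\mathcal{A}$ of period $t$ is measurable with respect to $\sigma(\mathcal{F}_t,U_t)$ and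 is chosen by Thompson sampling: $\mathbb{P}(A_t=a\mid\mathcal{F}_t)=\mathbb{P}(A^*=a\mid\mathcal{F}_t)$ almost surely for all $a\in\mathcal{A}$ and $t\ge 1$. Write $H(A^*)=-\sum_{a}\mathbb{P}(A^*=a)\log\mathbb{P}(A^*=a)$, $Z_t=(A_t,Y_{t,A_t})$, and $$H_t(A^*)=-\sum_{a}\mathbb{P}(A^*=a\mid\mathcal{F}_t)\log\mathbb{P}(A^*=a\mid\mathcal{F}_t),$$ $$I_t(A^*;Z_t)=H_t(A^*)-\mathbb{E}\Big[-\sum_{a}\mathbb{P}(A^*=a\mid\mathcal{F}_t,Z_t)\log\mathbb{P}(A^*=a\mid\mathcal{F}_t,Z_t)\,\Big|\,\mathcal{F}_t\Big],$$ with $0\log 0=0$. The information ratio is $$\Gamma_t=\frac{\big(\mathbb{E}[R(Y_{t,A^*})-R(Y_{t,A_t})\mid\mathcal{F}_t]\big)^2}{I_t(A^*;Z_t)}\in[0,\infty],$$ where $0/0=0$ and $x/0=\infty$ for $x>0$. **Proposition 5.** Suppose that for each $p\in\mathcal{P}$ there is $\theta_p\in\mathbb{R}^d$ such that $\mathbb{E}_{y\sim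 p_a}[R(y)]=a^{T}\theta_p$ for all $a\in\mathcal{A}$. Then for every $t\ge1$, $\Gamma_t\le d/2$ almost surely. Moreover, for every $T\in\mathbb{N}$, $$\mathbb{E}\Big[\sum_{t=1}^{T}\big(R(Y_{t,A^*})-R(Y_{t,A_t})\big)\Big]\le\sqrt{\tfrac12\,H(A^*)\,d\,T}.$$ -/

import Mathlib

open MeasureTheory ProbabilityTheory
open scoped ENNReal

noncomputable section

namespace ThompsonSampling

/-- The marginal `p_a`, for a distribution `p` of the vector of outcomes `(y_a)_a`. -/
def marginal {𝒜 𝒴 : Type*} [MeasurableSpace 𝒴] (p : Measure (𝒜 → 𝒴)) (a : 𝒜) : Measure 𝒴 :=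
  p.map (fun y => y a)

/-- The sigma-algebra `F_t` of the history before period `t`, generated by the pairs
`(A_s, Y_{s, A_s})` with `s < t`.  Periods are numbered from `0`, so `F_0` is trivial. -/
abbrev history {Ω 𝒜 𝒴 : Type*} [MeasurableSpace 𝒜] [MeasurableSpace 𝒴]
    (Y : ℕ → Ω → 𝒜 → 𝒴) (A : ℕ → Ω → 𝒜) (t : ℕ) : MeasurableSpace Ω :=
  ⨆ (s : ℕ) (_ : s < t),
    MeasurableSpace.comap (fun ω => (A s ω, Y s ω (A s ω))) inferInstance

/-- A Bayesian online optimization problem on the probability space `(Ω, μ)`, with actions in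
`𝒜` and outcomes in `𝒴`, together with a sequence of actions chosen by a randomized policy. -/
structure OnlineProblem {Ω : Type*} [MeasurableSpace Ω] (μ : Measure Ω)
    (𝒜 𝒴 𝒰 : Type*) [MeasurableSpace 𝒜] [MeasurableSpace 𝒴] [MeasurableSpace 𝒰] where
  /-- the family of candidate distributions of the vector of outcomes -/
  family : Set (Measure (𝒜 → 𝒴))
  family_prob : ∀ p ∈ family, IsProbabilityMeasure p
  /-- the random true distribution `p*` -/
  pstar : Ω → Measure (𝒜 → 𝒴)
  measurable_pstar : Measurable pstar
  pstar_mem : ∀ ω, pstar ω ∈ family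
  /-- `Y t ω a` is the outcome of action `a` in period `t` -/
  Y : ℕ → Ω → 𝒜 → 𝒴
  measurable_Y : ∀ t, Measurable (Y t)
  /-- conditionally on `p*`, the vectors `Y t` are independent with common law `p*` -/
  cond_iid : ∀ (s : Finset ℕ) (B : ℕ → Set (𝒜 → 𝒴)), (∀ t ∈ s, MeasurableSet (B t)) →
    μ⟦⋂ t ∈ s, Y t ⁻¹' B t | MeasurableSpace.comap pstar inferInstance⟧
      =ᵐ[μ] fun ω => ∏ t ∈ s, (pstar ω).real (B t)
  /-- the reward function -/
  R : 𝒴 → ℝ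
  measurable_R : Measurable R
  /-- the optimal action `A*`, a function of `p*` maximizing the mean reward under `p*` -/
  Astar : Ω → 𝒜
  measurable_Astar : Measurable[MeasurableSpace.comap pstar inferInstance] Astar
  Astar_optimal : ∀ᵐ ω ∂μ, ∀ a : 𝒜,
    ∫ y, R y ∂(marginal (pstar ω) a) ≤ ∫ y, R y ∂(marginal (pstar ω) (Astar ω))
  /-- the external randomness: `U i` is independent of all `U j` with `j ≠ i`, all outcomes and
  `p*`, jointly -/
  U : ℕ → Ω → 𝒰
  measurable_U : ∀ t, Measurable (U t)
  indep_U : ∀ i, Indep (MeasurableSpace.comap (U i) inferInstance)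
    ((⨆ (j : ℕ) (_ : j ≠ i), MeasurableSpace.comap (U j) inferInstance) ⊔
      (⨆ t : ℕ, MeasurableSpace.comap (Y t) inferInstance) ⊔
      MeasurableSpace.comap pstar inferInstance) μ
  /-- the action in period `t` depends only on the history and on `U t` -/
  A : ℕ → Ω → 𝒜
  measurable_A : ∀ t,
    Measurable[history Y A t ⊔ MeasurableSpace.comap (U t) inferInstance] (A t)

/-- Shannon entropy (natural logarithm) `-∑ P(X = x) log P(X = x)`. -/
def entropy {Ω 𝒳 : Type*} [MeasurableSpace Ω] (μ : Measure Ω) [Fintype 𝒳] (X : Ω → 𝒳) : ℝ :=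
  ∑ x, Real.negMulLog (μ.real (X ⁻¹' {x}))

/-- Entropy of `X` under the posterior measure given the sigma-algebra `m`. -/
def postEntropy {Ω 𝒳 : Type*} [Fintype 𝒳] (m : MeasurableSpace Ω) [MeasurableSpace Ω]
    (μ : Measure Ω) (X : Ω → 𝒳) (ω : Ω) : ℝ :=
  ∑ x, Real.negMulLog ((μ⟦X ⁻¹' {x} | m⟧) ω)

/-- Conditional entropy of `X` given `Z` under the posterior measure given `m`: the conditional
expectation given `m` of the entropy of the posterior given `m` and `Z`. -/
def postCondEntropy {Ω 𝒳 𝒵 : Type*} [Fintype 𝒳] [MeasurableSpace 𝒵]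
    (m : MeasurableSpace Ω) [MeasurableSpace Ω] (μ : Measure Ω) (X : Ω → 𝒳) (Z : Ω → 𝒵) : Ω → ℝ :=
  μ[postEntropy (m ⊔ MeasurableSpace.comap Z inferInstance) μ X | m]

/-- Mutual information of `X` and `Z` under the posterior measure given `m`. -/
def postMutualInfo {Ω 𝒳 𝒵 : Type*} [Fintype 𝒳] [MeasurableSpace 𝒵]
    (m : MeasurableSpace Ω) [MeasurableSpace Ω] (μ : Measure Ω) (X : Ω → 𝒳) (Z : Ω → 𝒵) (ω : Ω) : ℝ :=
  postEntropy m μ X ω - postCondEntropy m μ X Z ω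

namespace OnlineProblem

variable {Ω : Type*} [MeasurableSpace Ω] {μ : Measure Ω}
  {𝒜 𝒴 𝒰 : Type*} [MeasurableSpace 𝒜] [MeasurableSpace 𝒴] [MeasurableSpace 𝒰]

/-- The sigma-algebra `F_t`. -/
abbrev hist (P : OnlineProblem μ 𝒜 𝒴 𝒰) (t : ℕ) : MeasurableSpace Ω :=
  history P.Y P.A t

/-- The range of the reward function is at most `1`. -/
def RewardRangeLeOne (P : OnlineProblem μ 𝒜 𝒴 𝒰) : Prop :=
  ∀ y y' : 𝒴, P.R y - P.R y' ≤ 1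

/-- The actions are chosen by Thompson sampling: the conditional law of `A_t` given the history
is the posterior law of the optimal action. -/
def IsThompson (P : OnlineProblem μ 𝒜 𝒴 𝒰) : Prop :=
  ∀ (t : ℕ) (a : 𝒜),
    μ⟦P.A t ⁻¹' {a} | P.hist t⟧ =ᵐ[μ] μ⟦P.Astar ⁻¹' {a} | P.hist t⟧

/-- The regret `R(Y_{t, A*}) - R(Y_{t, A_t})` of period `t`. -/
def regretAt (P : OnlineProblem μ 𝒜 𝒴 𝒰) (t : ℕ) (ω : Ω) : ℝ :=
  P.R (P.Y t ω (P.Astar ω)) - P.R (P.Y t ω (P.A t ω))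

/-- The cumulative regret of the first `T` periods. -/
def regret (P : OnlineProblem μ 𝒜 𝒴 𝒰) (T : ℕ) (ω : Ω) : ℝ :=
  ∑ t ∈ Finset.range T, P.regretAt t ω

/-- The information gain `I_t(A*; (A_t, Y_{t, A_t}))`. -/
def infoGain [Fintype 𝒜] (P : OnlineProblem μ 𝒜 𝒴 𝒰) (t : ℕ) : Ω → ℝ :=
  postMutualInfo (P.hist t) μ P.Astar (fun ω => (P.A t ω, P.Y t ω (P.A t ω)))

/-- The information ratio `Γ_t`, the squared conditional expected regret over the information
gain.  It takes values in `[0, ∞]`, where `0 / 0 = 0` and `x / 0 = ∞` for `x > 0`. -/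
def infoRatio [Fintype 𝒜] (P : OnlineProblem μ 𝒜 𝒴 𝒰) (t : ℕ) (ω : Ω) : ℝ≥0∞ :=
  ENNReal.ofReal ((μ[P.regretAt t | P.hist t]) ω ^ 2) / ENNReal.ofReal (P.infoGain t ω)

end OnlineProblem

end ThompsonSampling

end

/-!
Under Thompson sampling `A_t` and `A*` have the same law given the history, so the conditional
expected regret of period `t` is the trace of the matrix of the conditional covariances of
`R(Y_{t, a})` and the indicator of `A* = b`.  Linearity of the mean rewards confines the columns of
this matrix to a subspace of dimension at most `d`, and by Cauchy–Schwarz the square of its trace is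
at most `d` times the square of its Frobenius norm, even after rescaling rows and columns by the
posterior probabilities.  The Gibbs variational principle and Hoeffding's lemma bound each weighted
column by half of the information that the observation carries about the event `A* = b`.  The
information gains of all periods add up to at most `H(A*)`, whence the regret bound.
-/

namespace ThompsonSampling

section LinearAlgebra

variable {ι : Type*} [Fintype ι]

lemma sum_norm_starProjection_sq {V : Type*} [NormedAddCommGroup V] [InnerProductSpace ℝ V]
    (E : Submodule ℝ V) [FiniteDimensional ℝ V] (b : OrthonormalBasis ι ℝ V) :
    ∑ i, ‖E.starProjection (b i)‖ ^ 2 = Module.finrank ℝ E := by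
  have hproj : LinearMap.IsProj E (E.starProjection : V →ₗ[ℝ] V) :=
    ⟨E.starProjection_apply_mem, fun x hx => E.starProjection_eq_self_iff.2 hx⟩
  rw [← hproj.trace, LinearMap.trace_eq_sum_inner _ b]
  refine Finset.sum_congr rfl fun i _ => ?_
  rw [ContinuousLinearMap.coe_coe, ← real_inner_self_eq_norm_sq,
    E.inner_starProjection_left_eq_right, E.starProjection_eq_self_iff.2
      (E.starProjection_apply_mem _)]

lemma sq_sum_inner_le_finrank_mul_sum_norm_sq {V : Type*} [NormedAddCommGroup V]
    [InnerProductSpace ℝ V] (E : Submodule ℝ V) [FiniteDimensional ℝ V]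
    (b : OrthonormalBasis ι ℝ V) {v : ι → V} (hv : ∀ i, v i ∈ E) :
    (∑ i, inner ℝ (b i) (v i)) ^ 2 ≤ Module.finrank ℝ E * ∑ i, ‖v i‖ ^ 2 := by
  have hinner : ∀ i, |inner ℝ (b i) (v i)| ≤ ‖E.starProjection (b i)‖ * ‖v i‖ := fun i => by
    conv_lhs => rw [← E.starProjection_eq_self_iff.2 (hv i)]
    rw [← E.inner_starProjection_left_eq_right]
    exact abs_real_inner_le_norm _ _
  calc (∑ i, inner ℝ (b i) (v i)) ^ 2
      ≤ (∑ i, ‖E.starProjection (b i)‖ * ‖v i‖) ^ 2 :=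
        sq_le_sq' (abs_le.1 ((Finset.abs_sum_le_sum_abs _ _).trans
          (Finset.sum_le_sum fun i _ => hinner i))).1
          ((Finset.sum_le_sum fun i _ => (le_abs_self _).trans (hinner i)))
    _ ≤ (∑ i, ‖E.starProjection (b i)‖ ^ 2) * ∑ i, ‖v i‖ ^ 2 :=
        Finset.sum_mul_sq_le_sq_mul_sq _ _ _
    _ = Module.finrank ℝ E * ∑ i, ‖v i‖ ^ 2 := by rw [sum_norm_starProjection_sq]

lemma sq_trace_le_finrank_mul_sum_sq (L : Submodule ℝ (ι → ℝ)) {M : Matrix ι ι ℝ}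
    (hM : ∀ b, M.col b ∈ L) :
    M.trace ^ 2 ≤ Module.finrank ℝ L * ∑ b, ∑ a, M a b ^ 2 := by
  classical
  let e := (WithLp.linearEquiv 2 ℝ (ι → ℝ)).symm
  have h := sq_sum_inner_le_finrank_mul_sum_norm_sq (L.map (e : (ι → ℝ) →ₗ[ℝ] _))
    (EuclideanSpace.basisFun ι ℝ) fun b => Submodule.mem_map_of_mem (hM b)
  rw [LinearEquiv.finrank_map_eq] at h
  simpa [e, Matrix.trace, EuclideanSpace.norm_sq_eq, EuclideanSpace.inner_single_left] using h

lemma sq_trace_le_finrank_div_two_mul_sum (L : Submodule ℝ (ι → ℝ)) {N : Matrix ι ι ℝ}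
    {α g : ι → ℝ} (hN : ∀ b, N.col b ∈ L) (hα : ∀ a, 0 ≤ α a) (hg : ∀ b, 0 ≤ g b)
    (hdiag : ∀ b, α b = 0 → N b b = 0)
    (hrow : ∀ b, 2 * ∑ a, α a * N a b ^ 2 ≤ α b * g b) :
    N.trace ^ 2 ≤ Module.finrank ℝ L / 2 * ∑ b, g b := by
  classical
  let D : Matrix ι ι ℝ := Matrix.of fun a b => √(α a) * ((√(α b))⁻¹ * N a b)
  have htrace : D.trace = N.trace := Finset.sum_congr rfl fun b _ => by
    rcases (hα b).eq_or_lt with h | h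
    · simp [D, hdiag b h.symm]
    · simp [D, mul_inv_cancel_left₀ (Real.sqrt_pos.2 h).ne']
  have hcol : ∀ b, ∑ a, D a b ^ 2 ≤ g b / 2 := fun b => by
    have hsum : ∑ a, D a b ^ 2 = (α b)⁻¹ * ∑ a, α a * N a b ^ 2 := by
      rw [Finset.mul_sum]
      refine Finset.sum_congr rfl fun a _ => ?_
      simp only [D, Matrix.of_apply, mul_pow, inv_pow, Real.sq_sqrt (hα _)]
      ring
    rcases (hα b).eq_or_lt with h | h
    · rw [hsum, ← h, inv_zero, zero_mul]
      linarith [hg b]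
    · rw [hsum, inv_mul_le_iff₀ h]
      linarith [hrow b]
  let S : (ι → ℝ) →ₗ[ℝ] (ι → ℝ) := (Matrix.diagonal fun a => √(α a)).mulVecLin
  have hD : ∀ b, D.col b ∈ L.map S := fun b =>
    Submodule.mem_map.2 ⟨_, L.smul_mem (√(α b))⁻¹ (hN b), by
      ext a; simp [S, D, Matrix.mulVec_diagonal, mul_left_comm]⟩
  calc N.trace ^ 2 ≤ Module.finrank ℝ (L.map S) * ∑ b, ∑ a, D a b ^ 2 :=
        htrace ▸ sq_trace_le_finrank_mul_sum_sq _ hD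
    _ ≤ Module.finrank ℝ L * ∑ b, g b / 2 := by
        gcongr with b
        · exact Submodule.finrank_map_le S L
        · exact hcol b
    _ = Module.finrank ℝ L / 2 * ∑ b, g b := by rw [← Finset.sum_div]; ring

end LinearAlgebra

section Entropy

variable {Ω : Type*} [MeasurableSpace Ω] {μ : Measure Ω} {u X : Ω → ℝ}

lemma mul_le_exp_sub_sub_negMulLog {x : ℝ} (hx : 0 ≤ x) (y : ℝ) :
    x * y ≤ Real.exp y - x - x.negMulLog := by
  rcases hx.eq_or_lt with rfl | hx
  · simp [Real.exp_nonneg]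
  · have h := mul_le_mul_of_nonneg_left (Real.add_one_le_exp (y - Real.log x)) hx.le
    rw [Real.exp_sub, Real.exp_log hx, mul_div_cancel₀ _ hx.ne'] at h
    rw [Real.negMulLog]
    linarith

lemma integral_mul_le_mul_log_integral_exp [NeZero μ] (hu : 0 ≤ᵐ[μ] u) (hui : Integrable u μ)
    (hlog : Integrable (fun ω => (u ω).negMulLog) μ) (huX : Integrable (fun ω => u ω * X ω) μ)
    (hexp : Integrable (fun ω => Real.exp (X ω)) μ) :
    ∫ ω, u ω * X ω ∂μ ≤ (∫ ω, u ω ∂μ) * Real.log (∫ ω, Real.exp (X ω) ∂μ)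
      + ((∫ ω, u ω ∂μ).negMulLog - ∫ ω, (u ω).negMulLog ∂μ) := by
  set α := ∫ ω, u ω ∂μ with hα
  set E := ∫ ω, Real.exp (X ω) ∂μ with hE_def
  rcases (integral_nonneg_of_ae hu).eq_or_lt with h | h
  · have h0 : u =ᵐ[μ] 0 := (integral_eq_zero_iff_of_nonneg_ae hu hui).1 h.symm
    have hX : ∫ ω, u ω * X ω ∂μ = 0 :=
      integral_eq_zero_of_ae (h0.mono fun ω hω => by simp [hω])
    have hN : ∫ ω, (u ω).negMulLog ∂μ = 0 :=
      integral_eq_zero_of_ae (h0.mono fun ω hω => by simp [hω])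
    simp [hX, hN, hα, ← h]
  · have hE : 0 < E := integral_exp_pos hexp
    -- The shift by `log (α / E)` is the one for which the right-hand sides integrate to `α - α`.
    have hpt : ∀ᵐ ω ∂μ, u ω * X ω + u ω * Real.log (α / E)
        ≤ α / E * Real.exp (X ω) - u ω - (u ω).negMulLog := hu.mono fun ω hω => by
      have := mul_le_exp_sub_sub_negMulLog hω (X ω + Real.log (α / E))
      rwa [Real.exp_add, Real.exp_log (div_pos h hE), mul_comm (Real.exp _), mul_add] at this
    have hdiff : Integrable (fun ω => α / E * Real.exp (X ω) - u ω) μ :=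
      (hexp.const_mul _).sub hui
    have hint := integral_mono_ae (huX.add (hui.mul_const _)) (hdiff.sub hlog) hpt
    simp only [Pi.add_apply, Pi.sub_apply] at hint
    rw [integral_add huX (hui.mul_const _), integral_sub hdiff hlog,
      integral_sub (hexp.const_mul _) hui, integral_mul_const, integral_const_mul, ← hα, ← hE_def,
      div_mul_cancel₀ _ hE.ne', Real.log_div h.ne' hE.ne'] at hint
    rw [Real.negMulLog]
    linarith

lemma sq_integral_mul_le_of_hasSubgaussianMGF [NeZero μ] {c : NNReal}
    (hX : HasSubgaussianMGF X c μ) (hu : 0 ≤ᵐ[μ] u) (hui : Integrable u μ)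
    (hlog : Integrable (fun ω => (u ω).negMulLog) μ) (huX : Integrable (fun ω => u ω * X ω) μ) :
    (∫ ω, u ω * X ω ∂μ) ^ 2 ≤ 2 * c * ((∫ ω, u ω ∂μ)
      * ((∫ ω, u ω ∂μ).negMulLog - ∫ ω, (u ω).negMulLog ∂μ)) := by
  set α := ∫ ω, u ω ∂μ
  set g := α.negMulLog - ∫ ω, (u ω).negMulLog ∂μ
  have hquad : ∀ l : ℝ, 0 ≤ (α * c / 2) * (l * l) + (-∫ ω, u ω * X ω ∂μ) * l + g := fun l => by
    have hgibbs := integral_mul_le_mul_log_integral_exp (X := fun ω => l * X ω) hu hui hlog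
      (by simpa only [mul_left_comm] using huX.const_mul l) (hX.integrable_exp_mul l)
    have hcgf : Real.log (∫ ω, Real.exp (l * X ω) ∂μ) ≤ c * l ^ 2 / 2 := hX.cgf_le l
    have hα : 0 ≤ α := integral_nonneg_of_ae hu
    simp only [mul_left_comm _ l, integral_const_mul] at hgibbs
    nlinarith [mul_le_mul_of_nonneg_left hcgf hα]
  have hdiscrim := discrim_le_zero hquad
  rw [discrim] at hdiscrim
  linarith

lemma two_mul_sq_integral_mul_sub_le [IsProbabilityMeasure μ] {a b : ℝ} (hu : 0 ≤ᵐ[μ] u)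
    (hui : Integrable u μ) (hlog : Integrable (fun ω => (u ω).negMulLog) μ)
    (hX : AEMeasurable X μ) (hXab : ∀ᵐ ω ∂μ, X ω ∈ Set.Icc a b) :
    2 * (∫ ω, u ω * X ω ∂μ - (∫ ω, u ω ∂μ) * ∫ ω, X ω ∂μ) ^ 2 ≤ (b - a) ^ 2 * ((∫ ω, u ω ∂μ)
      * ((∫ ω, u ω ∂μ).negMulLog - ∫ ω, (u ω).negMulLog ∂μ)) := by
  have huX : Integrable (fun ω => u ω * X ω) μ :=
    hui.mul_bdd (c := max |a| |b|) hX.aestronglyMeasurable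
      (hXab.mono fun ω hω => abs_le_max_abs_abs hω.1 hω.2)
  have huXc : Integrable (fun ω => u ω * (X ω - μ[X])) μ := by
    simp only [mul_sub]
    exact huX.sub (hui.mul_const _)
  have hcov : ∫ ω, u ω * (X ω - μ[X]) ∂μ
      = ∫ ω, u ω * X ω ∂μ - (∫ ω, u ω ∂μ) * ∫ ω, X ω ∂μ := by
    simp only [mul_sub]
    rw [integral_sub huX (hui.mul_const _), integral_mul_const]
  have h := sq_integral_mul_le_of_hasSubgaussianMGF (hasSubgaussianMGF_of_mem_Icc hX hXab) hu hui
    hlog huXc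
  rw [hcov] at h
  simp only [NNReal.coe_pow, NNReal.coe_div, coe_nnnorm, NNReal.coe_ofNat, div_pow,
    Real.norm_eq_abs, sq_abs] at h
  linarith

end Entropy

section CondExp

variable {Ω : Type*} {m m₀ : MeasurableSpace Ω} {μ : Measure Ω}

/-- The conditional covariance of `X` and `Y` given `m`, in product form. -/
noncomputable def condCov (m : MeasurableSpace Ω) {_ : MeasurableSpace Ω} (μ : Measure Ω)
    (X Y : Ω → ℝ) : Ω → ℝ :=
  μ[X * Y | m] - μ[X | m] * μ[Y | m]

lemma condCov_comm (X Y : Ω → ℝ) : condCov m μ X Y = condCov m μ Y X := by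
  simp only [condCov, mul_comm]

variable [IsFiniteMeasure μ]

lemma condExp_indicator_of_stronglyMeasurable {f : Ω → ℝ} {s : Set Ω} (hf : StronglyMeasurable[m] f)
    (hfi : Integrable f μ) (hs : MeasurableSet s) :
    μ[s.indicator f | m] =ᵐ[μ] f * μ⟦s | m⟧ := by
  have hmul : s.indicator f = f * s.indicator fun _ => 1 := by
    ext ω
    rw [Pi.mul_apply, ← Set.indicator_mul_right s f fun _ => 1]
    simp only [mul_one]
  rw [hmul]
  exact condExp_mul_of_stronglyMeasurable_left hf (hmul ▸ hfi.indicator hs)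
    ((integrable_const 1).indicator hs)

lemma exists_measure_condExp_comap_ae_eq_integral {β E : Type*} {mβ : MeasurableSpace β}
    [MeasurableSpace E] [StandardBorelSpace E] [Nonempty E] {X : Ω → β} (hX : Measurable X)
    {V : Ω → E} (hV : AEMeasurable V μ) :
    ∃ ν : Ω → Measure E, (∀ ω, IsProbabilityMeasure (ν ω)) ∧
      ∀ f : E → ℝ, Measurable f → Integrable (fun ω => f (V ω)) μ → ∀ᵐ ω ∂μ,
        Integrable f (ν ω) ∧ (μ[fun ω => f (V ω) | mβ.comap X]) ω = ∫ y, f y ∂ν ω := by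
  refine ⟨fun ω => condDistrib V X μ (X ω), fun ω => inferInstance, fun f hf hfi => ?_⟩
  have hmap : Integrable (fun p : β × E => f p.2) (μ.map fun ω => (X ω, V ω)) :=
    (integrable_map_measure (hf.comp measurable_snd).aestronglyMeasurable
      (hX.aemeasurable.prodMk hV)).2 hfi
  filter_upwards [condExp_ae_eq_integral_condDistrib hX hV hf.stronglyMeasurable hfi,
    hmap.condDistrib_ae hX.aemeasurable hV] with ω hcond hint
  exact ⟨hint, hcond⟩

lemma two_mul_condCov_sq_le_of_nonneg {u X : Ω → ℝ} {a b : ℝ} (hm : m ≤ m₀) (hu : 0 ≤ᵐ[μ] u)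
    (hui : Integrable u μ) (hlog : Integrable (fun ω => (u ω).negMulLog) μ)
    (hX : AEMeasurable X μ) (hXab : ∀ᵐ ω ∂μ, X ω ∈ Set.Icc a b) :
    ∀ᵐ ω ∂μ, 2 * condCov m μ u X ω ^ 2 ≤ (b - a) ^ 2 * ((μ[u | m]) ω
      * (((μ[u | m]) ω).negMulLog - (μ[fun ω => (u ω).negMulLog | m]) ω)) := by
  obtain ⟨ν, hν, hcond⟩ := exists_measure_condExp_comap_ae_eq_integral
    (measurable_id'' hm) (hui.aemeasurable.prodMk hX)
  rw [MeasurableSpace.comap_id] at hcond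
  have huX : Integrable (fun ω => u ω * X ω) μ :=
    hui.mul_bdd (c := max |a| |b|) hX.aestronglyMeasurable
      (hXab.mono fun ω hω => abs_le_max_abs_abs hω.1 hω.2)
  let S : Set (ℝ × ℝ) := Set.Ici 0 ×ˢ Set.Icc a b
  have hS : MeasurableSet S := measurableSet_Ici.prod measurableSet_Icc
  have hsupp : ∀ᵐ ω ∂μ, ∀ᵐ y ∂ν ω, y ∈ S := by
    have hzero : (fun ω => Sᶜ.indicator (fun _ => (1 : ℝ)) (u ω, X ω)) =ᵐ[μ] 0 := by
      filter_upwards [hu, hXab] with ω h1 h2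
      simp only [Set.indicator_compl, Pi.zero_apply]
      simp [S, h2.1, h2.2, show 0 ≤ u ω from h1]
    filter_upwards [hcond _ (measurable_const.indicator hS.compl)
      ((integrable_zero _ _ _).congr hzero.symm), condExp_congr_ae (m := m) hzero] with ω h1 h2
    have h3 := h1.2.symm.trans h2
    simpa [condExp_zero, integral_indicator hS.compl, measureReal_eq_zero_iff, mem_ae_iff] using h3
  filter_upwards [hsupp, hcond _ measurable_fst hui,
    hcond (fun y => y.1.negMulLog) (Real.continuous_negMulLog.measurable.comp measurable_fst) hlog,
    hcond _ measurable_snd (.of_mem_Icc a b hX hXab),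
    hcond (fun y => y.1 * y.2) (measurable_fst.mul measurable_snd) huX] with ω hS hu' hlog' hX' huX'
  have h := two_mul_sq_integral_mul_sub_le (hS.mono fun y hy => hy.1) hu'.1 hlog'.1
    measurable_snd.aemeasurable (hS.mono fun y hy => hy.2)
  rwa [← hu'.2, ← hX'.2, ← huX'.2, ← hlog'.2] at h

end CondExp

section EntropyGain

variable {Ω : Type*} {m m' G m₀ : MeasurableSpace Ω} {μ : Measure Ω} {x X : Ω → ℝ} {a b : ℝ}

/-- The term of the variable `x` in the information that `G` provides in addition to `m`: the mean
decrease of the entropy term `-p log p` of `p = E[x | m]` when `G` is revealed.  For `x` the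
indicator of an event, `p` is its posterior probability. -/
noncomputable def entropyGain (m G : MeasurableSpace Ω) {_ : MeasurableSpace Ω} (μ : Measure Ω)
    (x : Ω → ℝ) (ω : Ω) : ℝ :=
  ((μ[x | m]) ω).negMulLog - (μ[fun ω' => ((μ[x | G]) ω').negMulLog | m]) ω

lemma negMulLog_mem_Icc {p : ℝ} (hp : p ∈ Set.Icc (0 : ℝ) 1) : p.negMulLog ∈ Set.Icc (0 : ℝ) 1 :=
  ⟨Real.negMulLog_nonneg hp.1 hp.2,
    (Real.negMulLog_le_one_sub_self hp.1).trans (sub_le_self _ hp.1)⟩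

lemma memLp_top_of_mem_Icc (hX : AEStronglyMeasurable X μ) (hXab : ∀ᵐ ω ∂μ, X ω ∈ Set.Icc a b) :
    MemLp X ⊤ μ :=
  memLp_top_of_bound hX (max |a| |b|) (hXab.mono fun _ h => abs_le_max_abs_abs h.1 h.2)

variable [IsFiniteMeasure μ]

lemma integrable_negMulLog_of_mem_Icc (hx : AEStronglyMeasurable x μ)
    (hx01 : ∀ᵐ ω ∂μ, x ω ∈ Set.Icc (0 : ℝ) 1) : Integrable (fun ω => (x ω).negMulLog) μ :=
  .of_mem_Icc 0 1 (Real.continuous_negMulLog.measurable.comp_aemeasurable hx.aemeasurable)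
    (hx01.mono fun _ => negMulLog_mem_Icc)

lemma integrable_negMulLog_condExp (hm : m ≤ m₀) (hx : AEStronglyMeasurable x μ)
    (hx01 : ∀ᵐ ω ∂μ, x ω ∈ Set.Icc (0 : ℝ) 1) :
    Integrable (fun ω => ((μ[x | m]) ω).negMulLog) μ :=
  integrable_negMulLog_of_mem_Icc integrable_condExp.aestronglyMeasurable
    ((convex_Icc 0 1).condExp_mem hm (.of_mem_Icc 0 1 hx.aemeasurable hx01) isClosed_Icc hx01)

lemma integrable_entropyGain (hm : m ≤ m₀) (hx : AEStronglyMeasurable x μ)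
    (hx01 : ∀ᵐ ω ∂μ, x ω ∈ Set.Icc (0 : ℝ) 1) : Integrable (entropyGain m G μ x) μ :=
  (integrable_negMulLog_condExp hm hx hx01).sub integrable_condExp

lemma entropyGain_nonneg (hmG : m ≤ G) (hG : G ≤ m₀) (hx : AEStronglyMeasurable x μ)
    (hx01 : ∀ᵐ ω ∂μ, x ω ∈ Set.Icc (0 : ℝ) 1) : 0 ≤ᵐ[μ] entropyGain m G μ x := by
  have hxi : Integrable x μ := .of_mem_Icc 0 1 hx.aemeasurable hx01
  have hjensen := Real.concaveOn_negMulLog.condExp_map_le (hmG.trans hG)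
    (Real.continuous_negMulLog.upperSemicontinuous.upperSemicontinuousOn _)
    (((convex_Icc 0 1).condExp_mem hG hxi isClosed_Icc hx01).mono fun _ h => h.1) isClosed_Ici
    integrable_condExp (integrable_negMulLog_condExp hG hx hx01)
  filter_upwards [hjensen, condExp_condExp_of_le (f := x) (μ := μ) hmG hG] with ω hjensen htower
  rw [Function.comp_apply, htower] at hjensen
  exact sub_nonneg.2 hjensen

lemma condExp_entropyGain (hmm' : m ≤ m') (hm' : m' ≤ m₀)
    (hx : AEStronglyMeasurable x μ) (hx01 : ∀ᵐ ω ∂μ, x ω ∈ Set.Icc (0 : ℝ) 1)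
    (hxm : μ[x | m'] =ᵐ[μ] μ[x | m]) :
    μ[entropyGain m' G μ x | m] =ᵐ[μ] entropyGain m G μ x := by
  have hm := hmm'.trans hm'
  have hent : (fun ω => ((μ[x | m']) ω).negMulLog) =ᵐ[μ] fun ω => ((μ[x | m]) ω).negMulLog :=
    hxm.fun_comp Real.negMulLog
  have hself : μ[fun ω => ((μ[x | m]) ω).negMulLog | m] = fun ω => ((μ[x | m]) ω).negMulLog :=
    condExp_of_stronglyMeasurable hm
      (Real.continuous_negMulLog.comp_stronglyMeasurable stronglyMeasurable_condExp)
      (integrable_negMulLog_condExp hm hx hx01)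
  refine (condExp_sub (integrable_negMulLog_condExp hm' hx hx01) integrable_condExp m).trans ?_
  exact ((condExp_congr_ae hent).trans hself.eventuallyEq).sub (condExp_condExp_of_le hmm' hm')

lemma condCov_condExp_left (hmG : m ≤ G) (hG : G ≤ m₀) (hx : Integrable x μ)
    (hxX : Integrable (x * X) μ) (hX : StronglyMeasurable[G] X) :
    condCov m μ (μ[x | G]) X =ᵐ[μ] condCov m μ x X := by
  have hpull : μ[x | G] * X =ᵐ[μ] μ[x * X | G] :=
    (condExp_mul_of_stronglyMeasurable_right hX hxX hx).symm
  exact ((condExp_congr_ae hpull).trans (condExp_condExp_of_le hmG hG)).sub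
    ((condExp_condExp_of_le hmG hG).mul .rfl)

lemma two_mul_condCov_sq_le (hmG : m ≤ G) (hG : G ≤ m₀) (hx : AEStronglyMeasurable x μ)
    (hx01 : ∀ᵐ ω ∂μ, x ω ∈ Set.Icc (0 : ℝ) 1) (hX : StronglyMeasurable[G] X)
    (hXab : ∀ᵐ ω ∂μ, X ω ∈ Set.Icc a b) :
    ∀ᵐ ω ∂μ, 2 * condCov m μ x X ω ^ 2
      ≤ (b - a) ^ 2 * ((μ[x | m]) ω * entropyGain m G μ x ω) := by
  have hxi : Integrable x μ := .of_mem_Icc 0 1 hx.aemeasurable hx01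
  have hXG := (hX.mono hG).aestronglyMeasurable (μ := μ)
  have hxX : Integrable (x * X) μ := hxi.mul_of_top_left (memLp_top_of_mem_Icc hXG hXab)
  have hnonneg : 0 ≤ᵐ[μ] μ[x | G] := condExp_nonneg (hx01.mono fun _ h => h.1)
  filter_upwards [two_mul_condCov_sq_le_of_nonneg (hmG.trans hG) hnonneg integrable_condExp
      (integrable_negMulLog_condExp hG hx hx01) hXG.aemeasurable hXab,
    condCov_condExp_left hmG hG hxi hxX hX, condExp_condExp_of_le (f := x) (μ := μ) hmG hG]
    with ω hle hcov htower
  rwa [hcov, htower] at hle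

lemma condCov_eq_zero_of_condExp_eq_zero (hm : m ≤ m₀) (hx : AEStronglyMeasurable x μ)
    (hx01 : ∀ᵐ ω ∂μ, x ω ∈ Set.Icc (0 : ℝ) 1) (hX : AEStronglyMeasurable X μ)
    (hXab : ∀ᵐ ω ∂μ, X ω ∈ Set.Icc a b) :
    ∀ᵐ ω ∂μ, (μ[x | m]) ω = 0 → condCov m μ x X ω = 0 := by
  filter_upwards [two_mul_condCov_sq_le_of_nonneg hm (hx01.mono fun _ h => h.1)
    (.of_mem_Icc 0 1 hx.aemeasurable hx01) (integrable_negMulLog_of_mem_Icc hx hx01)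
    hX.aemeasurable hXab] with ω hle hzero
  rw [hzero, zero_mul, mul_zero] at hle
  exact pow_eq_zero_iff two_ne_zero |>.1 (le_antisymm (by linarith) (sq_nonneg _))

end EntropyGain

section RandomIndex

variable {Ω ι : Type*} {m m' G m₀ : MeasurableSpace Ω} {μ : Measure Ω} {x : Ω → ℝ} {a b : ℝ}
  {A : Ω → ι} {F : ι → Ω → ℝ}

lemma sum_indicator_preimage_singleton [Fintype ι] (A : Ω → ι) (F : ι → Ω → ℝ) :
    ∑ i, (A ⁻¹' {i}).indicator (F i) = fun ω => F (A ω) ω := by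
  classical
  ext ω
  simp [Finset.sum_apply, Set.indicator_apply]

variable [MeasurableSpace ι] [MeasurableSingletonClass ι]

lemma measurable_apply_of_countable [Countable ι] {β : Type*} [MeasurableSpace β] {H : ι → Ω → β}
    (hA : Measurable A) (hH : ∀ i, Measurable (H i)) : Measurable fun ω => H (A ω) ω := by
  have hH' : Measurable fun p : ι × Ω => H p.1 p.2 := measurable_from_prod_countable_right hH
  exact hH'.comp (hA.prodMk measurable_id)

lemma integrable_apply_of_finite [Finite ι] (hA : Measurable A)
    (hF : ∀ i, Integrable (F i) μ) : Integrable (fun ω => F (A ω) ω) μ := by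
  cases nonempty_fintype ι
  rw [← sum_indicator_preimage_singleton A F]
  exact integrable_finsetSum' _ fun i _ => (hF i).indicator (hA (measurableSet_singleton i))

lemma condExp_apply_eq_of_measurable [Finite ι] (hm' : m' ≤ m₀) (hA : Measurable[m'] A)
    (hF : ∀ i, Integrable (F i) μ) :
    μ[fun ω => F (A ω) ω | m'] =ᵐ[μ] fun ω => (μ[F (A ω) | m']) ω := by
  cases nonempty_fintype ι
  have hAi : ∀ i, MeasurableSet[m'] (A ⁻¹' {i}) := fun i => hA (measurableSet_singleton i)
  rw [← sum_indicator_preimage_singleton A F,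
    ← sum_indicator_preimage_singleton A fun i => μ[F i | m']]
  refine (condExp_finsetSum (fun i _ => (hF i).indicator (hm' _ (hAi i))) m').trans ?_
  exact eventuallyEq_sum fun i _ => condExp_indicator (hF i) (hAi i)

lemma condExp_apply_eq_sum_mul [Fintype ι] [IsFiniteMeasure μ] (hA : Measurable A)
    (hF : ∀ i, Integrable (F i) μ) (hFm : ∀ i, StronglyMeasurable[m] (F i)) :
    μ[fun ω => F (A ω) ω | m] =ᵐ[μ] ∑ i, F i * μ⟦A ⁻¹' {i} | m⟧ := by
  have hAi : ∀ i, MeasurableSet (A ⁻¹' {i}) := fun i => hA (measurableSet_singleton i)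
  rw [← sum_indicator_preimage_singleton A F]
  exact (condExp_finsetSum (fun i _ => (hF i).indicator (hAi i)) m).trans
    (eventuallyEq_sum fun i _ => condExp_indicator_of_stronglyMeasurable (hFm i) (hF i) (hAi i))

lemma stronglyMeasurable_condCov {X Y : Ω → ℝ} : StronglyMeasurable[m] (condCov m μ X Y) :=
  stronglyMeasurable_condExp.sub (stronglyMeasurable_condExp.mul stronglyMeasurable_condExp)

lemma memLp_top_condCov {X Y : Ω → ℝ} (hX : MemLp X ⊤ μ) (hY : MemLp Y ⊤ μ) :
    MemLp (condCov m μ X Y) ⊤ μ :=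
  ((hY.mul hX).condExp le_top).sub ((hY.condExp le_top).mul (hX.condExp le_top))

lemma condCov_congr_condExp {X Y : Ω → ℝ} (hX : μ[X | m'] =ᵐ[μ] μ[X | m])
    (hY : μ[Y | m'] =ᵐ[μ] μ[Y | m]) (hXY : μ[X * Y | m'] =ᵐ[μ] μ[X * Y | m]) :
    condCov m' μ X Y =ᵐ[μ] condCov m μ X Y :=
  hXY.sub (hX.mul hY)

lemma condCov_apply_eq_of_measurable [Finite ι] (hm' : m' ≤ m₀) (hA : Measurable[m'] A)
    (hF : ∀ i, Integrable (F i) μ) (hxF : ∀ i, Integrable (x * F i) μ) :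
    condCov m' μ x (fun ω => F (A ω) ω) =ᵐ[μ] fun ω => condCov m' μ x (F (A ω)) ω :=
  (condExp_apply_eq_of_measurable hm' hA hxF).sub
    ((ae_eq_refl _).mul (condExp_apply_eq_of_measurable hm' hA hF))

/-- The intermediate `σ`-algebra `m'` is the one in which `A`, but not yet `F A`, is revealed. -/
lemma two_mul_sum_condExp_mul_sq_condCov_le [Fintype ι] [IsFiniteMeasure μ] (hmm' : m ≤ m')
    (hm'G : m' ≤ G) (hG : G ≤ m₀) (hx : AEStronglyMeasurable x μ)
    (hx01 : ∀ᵐ ω ∂μ, x ω ∈ Set.Icc (0 : ℝ) 1) (hA : Measurable[m'] A)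
    (hF : ∀ i, AEStronglyMeasurable (F i) μ)
    (hFab : ∀ i, ∀ᵐ ω ∂μ, F i ω ∈ Set.Icc a b) (hFA : StronglyMeasurable[G] fun ω => F (A ω) ω)
    (hxm : μ[x | m'] =ᵐ[μ] μ[x | m]) (hFm : ∀ i, μ[F i | m'] =ᵐ[μ] μ[F i | m])
    (hxFm : ∀ i, μ[x * F i | m'] =ᵐ[μ] μ[x * F i | m]) :
    ∀ᵐ ω ∂μ, 2 * ∑ i, (μ⟦A ⁻¹' {i} | m⟧) ω * condCov m μ x (F i) ω ^ 2
      ≤ (b - a) ^ 2 * ((μ[x | m]) ω * entropyGain m G μ x ω) := by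
  have hm' := hm'G.trans hG
  have hF' : ∀ i, MemLp (F i) ⊤ μ := fun i => memLp_top_of_mem_Icc (hF i) (hFab i)
  have hx' : MemLp x ⊤ μ := memLp_top_of_mem_Icc hx hx01
  have hcov : ∀ i, Integrable (condCov m μ x (F i) ^ 2) μ := fun i => by
    have h := memLp_top_condCov (m := m) hx' (hF' i)
    exact pow_two (condCov m μ x (F i)) ▸ (h.mul h (r := ⊤)).integrable le_top
  have hgain : Integrable (entropyGain m' G μ x) μ := integrable_entropyGain hm' hx hx01
  have hprod : Integrable (μ[x | m] * entropyGain m' G μ x) μ :=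
    hgain.mul_of_top_right (hx'.condExp le_top)
  have hle : (fun ω => condCov m μ x (F (A ω)) ω ^ 2)
      ≤ᵐ[μ] ((b - a) ^ 2 / 2) • (μ[x | m] * entropyGain m' G μ x) := by
    filter_upwards [two_mul_condCov_sq_le hm'G hG hx hx01 hFA
        ((ae_all_iff.2 hFab).mono fun ω h => h (A ω)), hxm,
      condCov_apply_eq_of_measurable hm' hA (fun i => (hF' i).integrable le_top)
        (fun i => ((hF' i).mul hx' (r := ⊤)).integrable le_top),
      ae_all_iff.2 fun i => condCov_congr_condExp hxm (hFm i) (hxFm i)] with ω hle hxm hA hcongr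
    rw [hA, hcongr, hxm] at hle
    simp only [Pi.smul_apply, Pi.mul_apply, smul_eq_mul]
    linarith
  have hAm := hA.mono hm' le_rfl
  filter_upwards [condExp_mono (m := m) (integrable_apply_of_finite hAm hcov) (hprod.smul _) hle,
    condExp_apply_eq_sum_mul hAm hcov fun i => stronglyMeasurable_condCov.pow 2,
    condExp_smul ((b - a) ^ 2 / 2) (μ[x | m] * entropyGain m' G μ x) m (μ := μ),
    condExp_mul_of_stronglyMeasurable_left stronglyMeasurable_condExp hprod hgain,
    condExp_entropyGain (G := G) hmm' hm' hx hx01 hxm] with ω hmono hsum hsmul hpull htower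
  simp only [Pi.smul_apply, Pi.mul_apply, Pi.pow_apply, Finset.sum_apply, smul_eq_mul] at *
  rw [hsum, hsmul, hpull, htower] at hmono
  simp only [mul_comm ((μ⟦A ⁻¹' {_} | m⟧) ω)]
  linarith

end RandomIndex

section CondIndep

variable {Ω : Type*} {m m' u g m₀ : MeasurableSpace Ω} {μ : Measure Ω}

lemma isPiSystem_image2_inter {S T : Set (Set Ω)} (hS : IsPiSystem S) (hT : IsPiSystem T) :
    IsPiSystem (Set.image2 (· ∩ ·) S T) := by
  rintro _ ⟨s, hs, t, ht, rfl⟩ _ ⟨s', hs', t', ht', rfl⟩ hne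
  simp only [Set.inter_inter_inter_comm s t s' t'] at hne ⊢
  exact ⟨s ∩ s', hS _ hs _ hs' hne.left, t ∩ t', hT _ ht _ ht' hne.right, rfl⟩

lemma generateFrom_image2_inter {S T : Set (Set Ω)} (hS : Set.univ ∈ S) (hT : Set.univ ∈ T) :
    MeasurableSpace.generateFrom (Set.image2 (· ∩ ·) S T)
      = MeasurableSpace.generateFrom S ⊔ MeasurableSpace.generateFrom T := by
  rw [MeasurableSpace.generateFrom_sup_generateFrom]
  refine le_antisymm (MeasurableSpace.generateFrom_le ?_) (MeasurableSpace.generateFrom_mono ?_)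
  · rintro _ ⟨s, hs, t, ht, rfl⟩
    exact (MeasurableSpace.measurableSet_generateFrom (.inl hs)).inter
      (MeasurableSpace.measurableSet_generateFrom (.inr ht))
  · rintro s (hs | hs)
    · exact ⟨s, hs, _, hT, Set.inter_univ s⟩
    · exact ⟨_, hS, s, hs, Set.univ_inter s⟩

variable [IsFiniteMeasure μ]

lemma condExp_eq_of_forall_setIntegral_eq_of_generateFrom {S : Set (Set Ω)} (hm : m ≤ m₀)
    (hS : m = MeasurableSpace.generateFrom S) (hpi : IsPiSystem S) (huniv : Set.univ ∈ S)
    {f h : Ω → ℝ} (hf : Integrable f μ) (hh : Integrable h μ) (hhm : StronglyMeasurable[m] h)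
    (heq : ∀ s ∈ S, ∫ ω in s, h ω ∂μ = ∫ ω in s, f ω ∂μ) :
    μ[f | m] =ᵐ[μ] h := by
  have huniv : ∫ ω, h ω ∂μ = ∫ ω, f ω ∂μ := by simpa using heq _ huniv
  refine (ae_eq_condExp_of_forall_setIntegral_eq hm hf (fun _ _ _ => hh.integrableOn)
    (fun s hs _ => ?_) hhm.aestronglyMeasurable).symm
  induction s, hs using MeasurableSpace.induction_on_inter hS hpi with
  | empty => simp
  | basic s hs => exact heq s hs
  | compl s hs ih =>
    linarith [ih (measure_lt_top _ _), integral_add_compl (hm _ hs) hh,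
      integral_add_compl (hm _ hs) hf]
  | iUnion s hd hs ih =>
    rw [integral_iUnion (fun i => hm _ (hs i)) hd hh.integrableOn,
      integral_iUnion (fun i => hm _ (hs i)) hd hf.integrableOn]
    exact tsum_congr fun i => ih i (measure_lt_top _ _)

lemma condExp_sup_eq_of_forall_condExp_indicator_eq {S : Set (Set Ω)} (hm : m ≤ m₀) (hu : u ≤ m₀)
    (hS : u = MeasurableSpace.generateFrom S) (hpi : IsPiSystem S) (huniv : Set.univ ∈ S)
    {f h : Ω → ℝ} (hf : Integrable f μ) (hh : Integrable h μ) (hhm : StronglyMeasurable[m ⊔ u] h)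
    (heq : ∀ t ∈ S, μ[t.indicator h | m] =ᵐ[μ] μ[t.indicator f | m]) :
    μ[f | m ⊔ u] =ᵐ[μ] h := by
  have hgen : m ⊔ u = MeasurableSpace.generateFrom
      (Set.image2 (· ∩ ·) {s | MeasurableSet[m] s} S) := by
    rw [generateFrom_image2_inter (S := {s | MeasurableSet[m] s}) (@MeasurableSet.univ Ω m) huniv,
      ← hS, @MeasurableSpace.generateFrom_measurableSet Ω m]
  refine condExp_eq_of_forall_setIntegral_eq_of_generateFrom (sup_le hm hu) hgen
    (isPiSystem_image2_inter (@MeasurableSpace.isPiSystem_measurableSet Ω m) hpi)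
    ⟨_, @MeasurableSet.univ Ω m, _, huniv, Set.inter_univ _⟩ hf hh hhm ?_
  rintro _ ⟨s, hs, t, ht, rfl⟩
  have htm : MeasurableSet t := hu _ (hS ▸ MeasurableSpace.measurableSet_generateFrom ht)
  rw [← setIntegral_indicator htm, ← setIntegral_indicator htm,
    ← setIntegral_condExp hm (hh.indicator htm) hs, ← setIntegral_condExp hm (hf.indicator htm) hs]
  exact setIntegral_congr_ae (hm _ hs) ((heq t ht).mono fun ω h _ => h)

variable {W : Ω → ℝ} {t : Set Ω}

lemma condExp_indicator_of_indep (hm : m ≤ g) (hg : g ≤ m₀) (hu : u ≤ m₀) (hind : Indep u g μ)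
    (hW : StronglyMeasurable[g] W) (hWi : Integrable W μ) (ht : MeasurableSet[u] t) :
    μ[t.indicator W | m] =ᵐ[μ] μ.real t • μ[W | m] := by
  have hindep : μ⟦t | g⟧ =ᵐ[μ] fun _ => μ.real t := by
    refine (condExp_indep_eq hu hg (stronglyMeasurable_const.indicator ht) hind).trans ?_
    rw [integral_indicator_const _ (hu _ ht), smul_eq_mul, mul_one]
  have hpull : μ[t.indicator W | g] =ᵐ[μ] μ.real t • W :=
    (condExp_indicator_of_stronglyMeasurable hW hWi (hu _ ht)).trans <| by
      filter_upwards [hindep] with ω h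
      rw [Pi.mul_apply, h, mul_comm]
      rfl
  calc μ[t.indicator W | m] =ᵐ[μ] μ[μ[t.indicator W | g] | m] :=
        (condExp_condExp_of_le hm hg).symm
    _ =ᵐ[μ] μ[μ.real t • W | m] := condExp_congr_ae hpull
    _ =ᵐ[μ] μ.real t • μ[W | m] := condExp_smul _ _ _

lemma condExp_sup_of_indep (hm : m ≤ g) (hg : g ≤ m₀) (hu : u ≤ m₀) (hind : Indep u g μ)
    (hW : StronglyMeasurable[g] W) (hWi : Integrable W μ) :
    μ[W | m ⊔ u] =ᵐ[μ] μ[W | m] := by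
  refine condExp_sup_eq_of_forall_condExp_indicator_eq (hm.trans hg) hu
    (@MeasurableSpace.generateFrom_measurableSet Ω u).symm
    (@MeasurableSpace.isPiSystem_measurableSet Ω u) (@MeasurableSet.univ Ω u) hWi
    integrable_condExp (stronglyMeasurable_condExp.mono le_sup_left) fun t ht => ?_
  have hself : μ[μ[W | m] | m] =ᵐ[μ] μ[W | m] := condExp_condExp_of_le le_rfl (hm.trans hg)
  exact (condExp_indicator_of_indep hm hg hu hind (stronglyMeasurable_condExp.mono hm)
    integrable_condExp ht).trans ((hself.const_smul _).trans
      (condExp_indicator_of_indep hm hg hu hind hW hWi ht).symm)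

lemma condExp_eq_of_le_sup_of_indep (hmm' : m ≤ m') (hm' : m' ≤ m ⊔ u) (hm : m ≤ g) (hg : g ≤ m₀)
    (hu : u ≤ m₀) (hind : Indep u g μ) (hW : StronglyMeasurable[g] W) (hWi : Integrable W μ) :
    μ[W | m'] =ᵐ[μ] μ[W | m] := by
  have hmu : m ⊔ u ≤ m₀ := sup_le (hm.trans hg) hu
  calc μ[W | m'] =ᵐ[μ] μ[μ[W | m ⊔ u] | m'] := (condExp_condExp_of_le hm' hmu).symm
    _ =ᵐ[μ] μ[μ[W | m] | m'] := condExp_congr_ae (condExp_sup_of_indep hm hg hu hind hW hWi)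
    _ = μ[W | m] := condExp_of_stronglyMeasurable (hm'.trans hmu)
        (stronglyMeasurable_condExp.mono hmm') integrable_condExp

end CondIndep

section CondIID

variable {Ω ι E : Type*} {m m₀ : MeasurableSpace Ω} {μ : Measure Ω} [MeasurableSpace E]
  {p : Ω → Measure E}

/-- Conditionally on `m`, the variables `Y i` are independent with the common random law `p`. -/
def CondIID (m : MeasurableSpace Ω) {_ : MeasurableSpace Ω} (μ : Measure Ω) (p : Ω → Measure E)
    (Y : ι → Ω → E) : Prop :=
  ∀ (s : Finset ι) (B : ι → Set E), (∀ i ∈ s, MeasurableSet (B i)) →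
    μ⟦⋂ i ∈ s, Y i ⁻¹' B i | m⟧ =ᵐ[μ] fun ω => ∏ i ∈ s, (p ω).real (B i)

lemma integrable_measureReal_apply [IsFiniteMeasure μ] (hp : Measurable p)
    [∀ ω, IsProbabilityMeasure (p ω)] {B : Set E} (hB : MeasurableSet B) :
    Integrable (fun ω => (p ω).real B) μ :=
  .of_mem_Icc 0 1 ((Measure.measurable_coe hB).comp hp).ennreal_toReal.aemeasurable
    (ae_of_all _ fun _ => ⟨measureReal_nonneg, measureReal_le_one⟩)

namespace CondIID

variable {Y : ι → Ω → E} (h : CondIID m μ p Y)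
include h

lemma condExp_indicator_inter {I : Finset ι} {t : ι} (ht : t ∉ I) {B : Set E} {C : ι → Set E}
    (hB : MeasurableSet B) (hC : ∀ i ∈ I, MeasurableSet (C i)) :
    μ⟦(⋂ i ∈ I, Y i ⁻¹' C i) ∩ Y t ⁻¹' B | m⟧
      =ᵐ[μ] fun ω => (p ω).real B * (μ⟦⋂ i ∈ I, Y i ⁻¹' C i | m⟧) ω := by
  classical
  have hmeas : ∀ i ∈ insert t I, MeasurableSet (Function.update C t B i) := by
    rw [Finset.forall_mem_insert, Function.update_self]
    refine ⟨hB, fun i hi => ?_⟩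
    rw [Function.update_of_ne (ne_of_mem_of_not_mem hi ht)]
    exact hC i hi
  have hset : ⋂ i ∈ insert t I, Y i ⁻¹' Function.update C t B i
      = (⋂ i ∈ I, Y i ⁻¹' C i) ∩ Y t ⁻¹' B := by
    simp only [Function.apply_update fun i => Set.preimage (Y i)]
    rw [Finset.set_biInter_insert_update _ ht, Set.inter_comm]
  have hprod : ∀ ω, ∏ i ∈ insert t I, (p ω).real (Function.update C t B i)
      = (p ω).real B * ∏ i ∈ I, (p ω).real (C i) := fun ω => by
    simp only [Function.apply_update fun _ => (p ω).real]
    rw [Finset.prod_insert ht, Function.update_self, Finset.prod_update_of_notMem ht]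
  filter_upwards [h (insert t I) _ hmeas, h I C hC] with ω hinsert hI
  rw [hI, ← hprod ω, ← hinsert, hset]

lemma condExp_indicator_sup [IsFiniteMeasure μ] (hm : m ≤ m₀) (hp : Measurable[m] p)
    [∀ ω, IsProbabilityMeasure (p ω)] (hY : ∀ i, Measurable (Y i)) {J : Set ι} {t : ι} (ht : t ∉ J)
    {B : Set E} (hB : MeasurableSet B) :
    μ⟦Y t ⁻¹' B | m ⊔ ⨆ i ∈ J, MeasurableSpace.comap (Y i) inferInstance⟧
      =ᵐ[μ] fun ω => (p ω).real B := by
  have hpB : StronglyMeasurable[m] fun ω => (p ω).real B :=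
    ((Measure.measurable_coe hB).comp hp).ennreal_toReal.stronglyMeasurable
  have hpBi := integrable_measureReal_apply (μ := μ) (hp.mono hm le_rfl) hB
  refine condExp_sup_eq_of_forall_condExp_indicator_eq hm
    (iSup₂_le fun i _ => (hY i).comap_le)
    (generateFrom_piiUnionInter_measurableSet
      (fun i => MeasurableSpace.comap (Y i) inferInstance) J).symm
    (isPiSystem_piiUnionInter _ (fun i => @MeasurableSpace.isPiSystem_measurableSet Ω
      (MeasurableSpace.comap (Y i) inferInstance)) J)
    ⟨∅, by simp, fun _ => Set.univ, by simp, by simp⟩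
    ((integrable_const 1).indicator (hY t hB)) hpBi (hpB.mono le_sup_left) ?_
  rintro _ ⟨I, hI, f, hf, rfl⟩
  choose! C hC hCf using hf
  rw [← Set.iInter₂_congr hCf, Set.indicator_indicator]
  have hT : MeasurableSet (⋂ i ∈ I, Y i ⁻¹' C i) :=
    Finset.measurableSet_biInter _ fun i hi => hY i (hC i hi)
  exact (condExp_indicator_of_stronglyMeasurable hpB hpBi hT).trans
    (h.condExp_indicator_inter (fun htI => ht (hI htI)) hB hC).symm

end CondIID

variable [IsFiniteMeasure μ] [∀ ω, IsProbabilityMeasure (p ω)] {V : Ω → E}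

lemma restrict_bind_eq_map_of_condExp_indicator_eq (hm : m ≤ m₀) (hp : Measurable p)
    (hV : Measurable V)
    (hpV : ∀ B, MeasurableSet B → μ⟦V ⁻¹' B | m⟧ =ᵐ[μ] fun ω => (p ω).real B)
    {s : Set Ω} (hs : MeasurableSet[m] s) : (μ.restrict s).bind p = (μ.restrict s).map V := by
  ext B hB
  rw [Measure.bind_apply hB hp.aemeasurable, Measure.map_apply hV hB]
  have hfin : ∫⁻ ω in s, p ω B ∂μ ≠ ⊤ :=
    ((lintegral_mono fun ω => prob_le_one (μ := p ω)).trans_lt (by simp)).ne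
  rw [← ENNReal.toReal_eq_toReal_iff' hfin (measure_ne_top _ _)]
  calc (∫⁻ ω in s, p ω B ∂μ).toReal = ∫ ω in s, (p ω).real B ∂μ :=
        (integral_toReal ((Measure.measurable_coe hB).comp hp).aemeasurable
          (ae_of_all _ fun _ => measure_lt_top _ _)).symm
    _ = ∫ ω in s, (V ⁻¹' B).indicator (fun _ => (1 : ℝ)) ω ∂μ := by
        rw [← setIntegral_condExp hm ((integrable_const (1 : ℝ)).indicator (hV hB)) hs]
        exact setIntegral_congr_ae (hm _ hs) ((hpV B hB).mono fun ω h _ => h.symm)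
    _ = (μ.restrict s).real (V ⁻¹' B) := integral_indicator_one (hV hB)

lemma condExp_comp_eq_integral_of_condExp_indicator_eq (hm : m ≤ m₀) (hp : Measurable[m] p)
    (hV : Measurable V)
    (hpV : ∀ B, MeasurableSet B → μ⟦V ⁻¹' B | m⟧ =ᵐ[μ] fun ω => (p ω).real B)
    {f : E → ℝ} (hf : Measurable f) (hfV : Integrable (fun ω => f (V ω)) μ) :
    μ[fun ω => f (V ω) | m] =ᵐ[μ] fun ω => ∫ y, f y ∂p ω := by
  let κ : @Kernel Ω E m _ := @Kernel.mk _ _ m _ p hp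
  have : @IsMarkovKernel _ _ m _ κ := @IsMarkovKernel.mk _ _ m _ κ fun ω => inferInstance
  let κ₀ : Kernel Ω E := ⟨p, hp.mono hm le_rfl⟩
  have : IsMarkovKernel κ₀ := ⟨fun ω => inferInstance⟩
  have hmap : ∀ s, MeasurableSet[m] s →
      (κ₀ ∘ₖ Kernel.const Unit (μ.restrict s)) () = (μ.restrict s).map V := fun s hs => by
    rw [Kernel.comp_apply, Kernel.const_apply]
    exact restrict_bind_eq_map_of_condExp_indicator_eq hm (hp.mono hm le_rfl) hV hpV hs
  have hint : ∀ s, MeasurableSet[m] s →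
      Integrable f ((κ₀ ∘ₖ Kernel.const Unit (μ.restrict s)) ()) := fun s hs => by
    rw [hmap s hs, integrable_map_measure hf.aestronglyMeasurable hV.aemeasurable]
    exact hfV.integrableOn
  refine (ae_eq_condExp_of_forall_setIntegral_eq hm hfV
    (fun s hs _ => (hint s hs).integral_comp) (fun s hs _ => ?_)
    (hf.stronglyMeasurable.integral_kernel (κ := κ)).aestronglyMeasurable).symm
  have hcomp := Kernel.integral_comp (hint s hs)
  rw [hmap s hs, integral_map hV.aemeasurable hf.aestronglyMeasurable] at hcomp
  exact hcomp.symm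

end CondIID

namespace OnlineProblem

variable {Ω : Type*} [MeasurableSpace Ω] {μ : Measure Ω}
  {𝒜 𝒴 𝒰 : Type*} [MeasurableSpace 𝒜] [MeasurableSpace 𝒴] [MeasurableSpace 𝒰]
  (P : OnlineProblem μ 𝒜 𝒴 𝒰)

/-- The `σ`-algebra generated by `p*`. -/
abbrev sigmaPstar : MeasurableSpace Ω :=
  MeasurableSpace.comap P.pstar inferInstance

/-- The `σ`-algebra generated by `p*`, the outcomes `Y i` for `i < t` and the external randomness
`U j` for `j < s`. -/
abbrev sigmaPast (t s : ℕ) : MeasurableSpace Ω :=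
  (P.sigmaPstar ⊔ ⨆ i ∈ Set.Iio t, MeasurableSpace.comap (P.Y i) inferInstance) ⊔
    ⨆ (j : ℕ) (_ : j < s), MeasurableSpace.comap (P.U j) inferInstance

/-- The `σ`-algebra generated by all the randomness of the problem except `U i`. -/
abbrev sigmaWithout (i : ℕ) : MeasurableSpace Ω :=
  (⨆ (j : ℕ) (_ : j ≠ i), MeasurableSpace.comap (P.U j) inferInstance) ⊔
    (⨆ t : ℕ, MeasurableSpace.comap (P.Y t) inferInstance) ⊔ P.sigmaPstar

lemma sigmaPstar_le : P.sigmaPstar ≤ ‹MeasurableSpace Ω› :=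
  P.measurable_pstar.comap_le

lemma measurable_Astar_ambient : Measurable P.Astar :=
  P.measurable_Astar.mono P.sigmaPstar_le le_rfl

lemma sigmaWithout_le (i : ℕ) : P.sigmaWithout i ≤ ‹MeasurableSpace Ω› :=
  sup_le (sup_le (iSup₂_le fun j _ => (P.measurable_U j).comap_le)
    (iSup_le fun t => (P.measurable_Y t).comap_le)) P.sigmaPstar_le

lemma comap_Y_le_sigmaWithout (t i : ℕ) :
    MeasurableSpace.comap (P.Y t) inferInstance ≤ P.sigmaWithout i :=
  le_sup_of_le_left <| le_sup_of_le_right <|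
    le_iSup (fun t => MeasurableSpace.comap (P.Y t) inferInstance) t

lemma sigmaPstar_le_sigmaPast (t s : ℕ) : P.sigmaPstar ≤ P.sigmaPast t s :=
  le_sup_of_le_left le_sup_left

lemma sigmaPast_le_sigmaWithout (t : ℕ) {s i : ℕ} (hs : s ≤ i) :
    P.sigmaPast t s ≤ P.sigmaWithout i := by
  refine sup_le (sup_le le_sup_right (iSup₂_le fun j _ => P.comap_Y_le_sigmaWithout j i))
    (le_sup_of_le_left <| le_sup_of_le_left ?_)
  exact biSup_mono fun j hj => (hj.trans_le hs).ne

lemma sigmaPast_succ (t s : ℕ) :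
    P.sigmaPast t (s + 1) = P.sigmaPast t s ⊔ MeasurableSpace.comap (P.U s) inferInstance := by
  rw [sigmaPast, Nat.iSup_lt_succ, ← sup_assoc]

lemma sigmaPast_mono {t t' s s' : ℕ} (ht : t ≤ t') (hs : s ≤ s') :
    P.sigmaPast t s ≤ P.sigmaPast t' s' :=
  sup_le_sup (sup_le_sup_left (biSup_mono fun _ hi => hi.trans_le ht) _)
    (biSup_mono fun _ hj => hj.trans_le hs)

lemma comap_Y_le_sigmaPast {i t : ℕ} (hi : i < t) (s : ℕ) :
    MeasurableSpace.comap (P.Y i) inferInstance ≤ P.sigmaPast t s :=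
  le_sup_of_le_left <| le_sup_of_le_right <|
    le_biSup (fun i => MeasurableSpace.comap (P.Y i) inferInstance) (Set.mem_Iio.2 hi)

lemma comap_U_le_sigmaPast (t : ℕ) {j s : ℕ} (hj : j < s) :
    MeasurableSpace.comap (P.U j) inferInstance ≤ P.sigmaPast t s :=
  le_sup_of_le_right <| le_biSup (fun j => MeasurableSpace.comap (P.U j) inferInstance) hj

/-- The observation `Z_t = (A_t, Y_{t, A_t})` of period `t`. -/
abbrev observation (t : ℕ) (ω : Ω) : 𝒜 × 𝒴 :=
  (P.A t ω, P.Y t ω (P.A t ω))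

lemma hist_succ (t : ℕ) :
    P.hist (t + 1) = P.hist t ⊔ MeasurableSpace.comap (P.observation t) inferInstance :=
  Nat.iSup_lt_succ _ _

lemma hist_mono : Monotone P.hist :=
  fun _ _ h => biSup_mono fun _ hi => hi.trans_le h

lemma measurable_observation (t : ℕ) : Measurable[P.hist (t + 1)] (P.observation t) :=
  measurable_iff_comap_le.2 (P.hist_succ t ▸ le_sup_right)

variable [Countable 𝒜] [MeasurableSingletonClass 𝒜]

lemma hist_le_sigmaPast (t : ℕ) : P.hist t ≤ P.sigmaPast t t := by
  induction t using Nat.strong_induction_on with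
  | _ t ih =>
    refine iSup₂_le fun s hs => Measurable.comap_le ?_
    have hA : Measurable[P.sigmaPast t t] (P.A s) :=
      (P.measurable_A s).mono (sup_le ((ih s hs).trans (P.sigmaPast_mono hs.le hs.le))
        (P.comap_U_le_sigmaPast t hs)) le_rfl
    have hY : Measurable[P.sigmaPast t t] (P.Y s) :=
      (comap_measurable (P.Y s)).mono (P.comap_Y_le_sigmaPast hs t) le_rfl
    exact hA.prodMk (measurable_apply_of_countable hA fun a => (measurable_pi_apply a).comp hY)

lemma hist_le_sigmaWithout (t : ℕ) : P.hist t ≤ P.sigmaWithout t :=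
  (P.hist_le_sigmaPast t).trans (P.sigmaPast_le_sigmaWithout t le_rfl)

lemma hist_le (t : ℕ) : P.hist t ≤ ‹MeasurableSpace Ω› :=
  (P.hist_le_sigmaWithout t).trans (P.sigmaWithout_le t)

end OnlineProblem

section Linearity

variable {Ω ι : Type*} {m G m₀ : MeasurableSpace Ω} {μ : Measure Ω} [IsFiniteMeasure μ] [Finite ι]
  {L : Submodule ℝ (ι → ℝ)} {F : ι → Ω → ℝ} {x : Ω → ℝ}

lemma condExp_mem_submodule (hm : m ≤ m₀) (hF : ∀ i, Integrable (F i) μ)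
    (hL : ∀ᵐ ω ∂μ, (fun i => F i ω) ∈ L) : ∀ᵐ ω ∂μ, (fun i => (μ[F i | m]) ω) ∈ L := by
  cases nonempty_fintype ι
  have hFi : Integrable (fun ω i => F i ω) μ := .of_eval hF
  have hproj : ∀ i, (fun ω => (μ[fun ω i => F i ω | m]) ω i) =ᵐ[μ] μ[F i | m] := fun i =>
    (ContinuousLinearMap.proj (R := ℝ) (φ := fun _ : ι => ℝ) i).comp_condExp_comm hFi
  filter_upwards [L.convex.condExp_mem hm hFi L.closed_of_finiteDimensional hL,
    ae_all_iff.2 hproj] with ω hmem hproj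
  rwa [funext hproj] at hmem

lemma condCov_mem_submodule (hm : m ≤ m₀) (hF : ∀ i, Integrable (F i) μ)
    (hxF : ∀ i, Integrable (x * F i) μ) (hL : ∀ᵐ ω ∂μ, (fun i => F i ω) ∈ L) :
    ∀ᵐ ω ∂μ, (fun i => condCov m μ x (F i) ω) ∈ L := by
  have hxL : ∀ᵐ ω ∂μ, (fun i => (x * F i) ω) ∈ L := hL.mono fun ω h => L.smul_mem (x ω) h
  filter_upwards [condExp_mem_submodule hm hF hL, condExp_mem_submodule hm hxF hxL] with ω h hx
  exact L.sub_mem hx (L.smul_mem _ h)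

lemma condCov_mem_submodule_of_condExp_mem (hmG : m ≤ G) (hG : G ≤ m₀) (hx : MemLp x ⊤ μ)
    (hxm : StronglyMeasurable[G] x) (hF : ∀ i, Integrable (F i) μ)
    (hL : ∀ᵐ ω ∂μ, (fun i => (μ[F i | G]) ω) ∈ L) :
    ∀ᵐ ω ∂μ, (fun i => condCov m μ x (F i) ω) ∈ L := by
  have hcongr : ∀ i, condCov m μ x (μ[F i | G]) =ᵐ[μ] condCov m μ x (F i) := fun i => by
    rw [condCov_comm x, condCov_comm x]
    exact condCov_condExp_left hmG hG (hF i) ((hF i).mul_of_top_left hx) hxm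
  filter_upwards [condCov_mem_submodule (x := x) (hmG.trans hG)
    (fun _ => integrable_condExp) (fun _ => integrable_condExp.mul_of_top_right hx) hL,
    ae_all_iff.2 hcongr] with ω hmem hcongr
  rwa [funext hcongr] at hmem

end Linearity

namespace OnlineProblem

variable {Ω : Type*} [MeasurableSpace Ω] {μ : Measure Ω}
  {𝒜 𝒴 𝒰 : Type*} [MeasurableSpace 𝒜] [MeasurableSpace 𝒴] [MeasurableSpace 𝒰]
  (P : OnlineProblem μ 𝒜 𝒴 𝒰)

/-- The reward `R(Y_{t, a})` of the action `a` in period `t`. -/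
abbrev reward (t : ℕ) (a : 𝒜) (ω : Ω) : ℝ :=
  P.R (P.Y t ω a)

/-- The vector of the mean rewards of the actions under the distribution `p`. -/
noncomputable def meanReward (p : Measure (𝒜 → 𝒴)) (a : 𝒜) : ℝ :=
  ∫ y, P.R y ∂marginal p a

variable {P} in
lemma RewardRangeLeOne.exists_forall_mem_Icc (hR : P.RewardRangeLeOne) :
    ∃ c, ∀ y, P.R y ∈ Set.Icc c (c + 1) := by
  refine ⟨⨅ y, P.R y, fun y => ?_⟩
  have : Nonempty 𝒴 := ⟨y⟩
  have hlower : P.R y - 1 ≤ ⨅ y, P.R y := le_ciInf fun y' => by linarith [hR y y']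
  exact ⟨ciInf_le ⟨P.R y - 1, by rintro _ ⟨y', rfl⟩; linarith [hR y y']⟩ y, by linarith⟩

lemma measurable_reward (t : ℕ) (a : 𝒜) :
    Measurable[MeasurableSpace.comap (P.Y t) inferInstance] (P.reward t a) :=
  P.measurable_R.comp ((measurable_pi_apply a).comp (comap_measurable (P.Y t)))

variable {P} in
lemma integrable_reward [IsFiniteMeasure μ] (hR : P.RewardRangeLeOne) (t : ℕ) (a : 𝒜) :
    Integrable (P.reward t a) μ := by
  obtain ⟨c, hc⟩ := hR.exists_forall_mem_Icc
  exact .of_mem_Icc c (c + 1) ((P.measurable_reward t a).mono (P.measurable_Y t).comap_le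
    le_rfl).aemeasurable (ae_of_all _ fun ω => hc _)

variable [IsProbabilityMeasure μ]

lemma condExp_comp_Y_sigmaPast (t s : ℕ) {f : (𝒜 → 𝒴) → ℝ} (hf : Measurable f)
    (hfi : Integrable (fun ω => f (P.Y t ω)) μ) :
    μ[fun ω => f (P.Y t ω) | P.sigmaPast t s] =ᵐ[μ] fun ω => ∫ y, f y ∂P.pstar ω := by
  have hprob : ∀ ω, IsProbabilityMeasure (P.pstar ω) := fun ω => P.family_prob _ (P.pstar_mem ω)
  induction s with
  | zero =>
    have hzero : P.sigmaPast t 0 = P.sigmaPstar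
        ⊔ ⨆ i ∈ Set.Iio t, MeasurableSpace.comap (P.Y i) inferInstance := by simp [sigmaPast]
    rw [hzero]
    have hiid : CondIID P.sigmaPstar μ P.pstar P.Y := P.cond_iid
    refine condExp_comp_eq_integral_of_condExp_indicator_eq
      (sup_le P.sigmaPstar_le (iSup₂_le fun i _ => (P.measurable_Y i).comap_le))
      ((comap_measurable P.pstar).mono le_sup_left le_rfl) (P.measurable_Y t) (fun B hB => ?_)
      hf hfi
    exact hiid.condExp_indicator_sup P.sigmaPstar_le (comap_measurable P.pstar) P.measurable_Y
      Set.self_notMem_Iio hB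
  | succ s ih =>
    rw [P.sigmaPast_succ]
    exact (condExp_sup_of_indep (P.sigmaPast_le_sigmaWithout t le_rfl) (P.sigmaWithout_le s)
      (P.measurable_U s).comap_le (P.indep_U s) ((hf.comp (comap_measurable (P.Y t))).mono
        (P.comap_Y_le_sigmaWithout t s) le_rfl).stronglyMeasurable hfi).trans ih

lemma condExp_reward_sigmaPast {P : OnlineProblem μ 𝒜 𝒴 𝒰} (hR : P.RewardRangeLeOne)
    (t s : ℕ) (a : 𝒜) :
    μ[P.reward t a | P.sigmaPast t s] =ᵐ[μ] fun ω => P.meanReward (P.pstar ω) a := by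
  refine (P.condExp_comp_Y_sigmaPast t s (P.measurable_R.comp (measurable_pi_apply a))
    (integrable_reward hR t a)).trans (ae_of_all _ fun ω => ?_)
  exact (integral_map (measurable_pi_apply a).aemeasurable
    P.measurable_R.aestronglyMeasurable).symm

end OnlineProblem

section PosteriorSampling

variable {Ω ι : Type*} {m m' G m₀ : MeasurableSpace Ω} {μ : Measure Ω}
  {A B : Ω → ι} {F : ι → Ω → ℝ} {a b : ℝ}

/-- The indicator function of the event `B = i`. -/
noncomputable abbrev eqIndicator (B : Ω → ι) (i : ι) : Ω → ℝ :=
  (B ⁻¹' {i}).indicator fun _ => 1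

lemma eqIndicator_mem_Icc (B : Ω → ι) (i : ι) (ω : Ω) : eqIndicator B i ω ∈ Set.Icc (0 : ℝ) 1 :=
  ⟨Set.indicator_nonneg (fun _ _ => zero_le_one) ω,
    Set.indicator_le_self' (fun _ _ => zero_le_one) ω⟩

variable [MeasurableSpace ι] [MeasurableSingletonClass ι]

lemma stronglyMeasurable_eqIndicator (hB : Measurable B) (i : ι) :
    StronglyMeasurable (eqIndicator B i) :=
  stronglyMeasurable_const.indicator (hB (measurableSet_singleton i))

lemma memLp_top_eqIndicator (hB : Measurable B) (i : ι) : MemLp (eqIndicator B i) ⊤ μ :=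
  memLp_top_of_mem_Icc (stronglyMeasurable_eqIndicator hB i).aestronglyMeasurable
    (ae_of_all _ (eqIndicator_mem_Icc B i))

variable [Fintype ι] [IsFiniteMeasure μ]

lemma postMutualInfo_eq_sum_entropyGain {β : Type*} [MeasurableSpace β] {Z : Ω → β} (hm : m ≤ m₀)
    (hZ : Measurable Z) (hB : Measurable B) :
    postMutualInfo m μ B Z
      =ᵐ[μ] ∑ i, entropyGain m (m ⊔ MeasurableSpace.comap Z inferInstance) μ (eqIndicator B i) := by
  have hG : m ⊔ MeasurableSpace.comap Z inferInstance ≤ m₀ := sup_le hm hZ.comap_le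
  have hsum : postEntropy (m ⊔ MeasurableSpace.comap Z inferInstance) μ B
      = ∑ i, fun ω => ((μ⟦B ⁻¹' {i} | m ⊔ MeasurableSpace.comap Z inferInstance⟧) ω).negMulLog := by
    ext ω
    rw [Finset.sum_apply]
    rfl
  have hcond := condExp_finsetSum (m := m) (s := Finset.univ) fun i _ =>
    integrable_negMulLog_condExp (μ := μ) hG
      (stronglyMeasurable_eqIndicator hB i).aestronglyMeasurable
      (ae_of_all _ (eqIndicator_mem_Icc B i))
  filter_upwards [hcond] with ω hcond
  rw [postMutualInfo, postCondEntropy, hsum, hcond, Finset.sum_apply, Finset.sum_apply,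
    postEntropy, ← Finset.sum_sub_distrib]
  rfl

lemma condExp_apply_eq_sum_mul_condExp (hmm' : m ≤ m') (hm' : m' ≤ m₀) (hA : Measurable[m'] A)
    (hF : ∀ i, Integrable (F i) μ) (hFm : ∀ i, μ[F i | m'] =ᵐ[μ] μ[F i | m]) :
    μ[fun ω => F (A ω) ω | m] =ᵐ[μ] ∑ i, μ[F i | m] * μ⟦A ⁻¹' {i} | m⟧ := by
  have hcond : μ[fun ω => F (A ω) ω | m'] =ᵐ[μ] fun ω => (μ[F (A ω) | m]) ω := by
    filter_upwards [condExp_apply_eq_of_measurable hm' hA hF, ae_all_iff.2 hFm] with ω h h'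
    rw [h, h']
  calc μ[fun ω => F (A ω) ω | m] =ᵐ[μ] μ[μ[fun ω => F (A ω) ω | m'] | m] :=
        (condExp_condExp_of_le hmm' hm').symm
    _ =ᵐ[μ] μ[fun ω => (μ[F (A ω) | m]) ω | m] := condExp_congr_ae hcond
    _ =ᵐ[μ] ∑ i, μ[F i | m] * μ⟦A ⁻¹' {i} | m⟧ :=
        condExp_apply_eq_sum_mul (hA.mono hm' le_rfl) (fun _ => integrable_condExp)
          fun _ => stronglyMeasurable_condExp

lemma condExp_apply_sub_apply_eq_sum_condCov (hmm' : m ≤ m') (hm' : m' ≤ m₀)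
    (hA : Measurable[m'] A) (hB : Measurable B) (hF : ∀ i, Integrable (F i) μ)
    (hFm : ∀ i, μ[F i | m'] =ᵐ[μ] μ[F i | m])
    (hAB : ∀ i, μ⟦A ⁻¹' {i} | m⟧ =ᵐ[μ] μ⟦B ⁻¹' {i} | m⟧) :
    μ[fun ω => F (B ω) ω - F (A ω) ω | m] =ᵐ[μ] ∑ i, condCov m μ (eqIndicator B i) (F i) := by
  have hBF : μ[fun ω => F (B ω) ω | m] =ᵐ[μ] ∑ i, μ[eqIndicator B i * F i | m] := by
    have hsum : (fun ω => F (B ω) ω) = ∑ i, eqIndicator B i * F i := by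
      rw [← sum_indicator_preimage_singleton B F]
      refine Finset.sum_congr rfl fun i _ => ?_
      ext ω
      rw [Pi.mul_apply, ← Set.indicator_mul_left _ (fun _ => (1 : ℝ)) (F i)]
      simp only [one_mul]
    rw [hsum]
    exact condExp_finsetSum (fun i _ => (hF i).mul_of_top_right (memLp_top_eqIndicator hB i)) m
  filter_upwards [condExp_sub (integrable_apply_of_finite hB hF)
    (integrable_apply_of_finite (hA.mono hm' le_rfl) hF) m, hBF,
    condExp_apply_eq_sum_mul_condExp hmm' hm' hA hF hFm, ae_all_iff.2 hAB] with ω hsub hB hA hAB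
  refine hsub.trans ?_
  rw [Pi.sub_apply, hB, hA]
  simp only [Finset.sum_apply, condCov, Pi.sub_apply, Pi.mul_apply, hAB, Finset.sum_sub_distrib,
    mul_comm]

lemma sq_condExp_apply_sub_apply_le (L : Submodule ℝ (ι → ℝ)) (hmm' : m ≤ m') (hm'G : m' ≤ G)
    (hG : G ≤ m₀) (hA : Measurable[m'] A) (hB : Measurable B)
    (hAB : ∀ i, μ⟦A ⁻¹' {i} | m⟧ =ᵐ[μ] μ⟦B ⁻¹' {i} | m⟧)
    (hF : ∀ i, AEStronglyMeasurable (F i) μ) (hFab : ∀ i, ∀ᵐ ω ∂μ, F i ω ∈ Set.Icc a b)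
    (hFA : StronglyMeasurable[G] fun ω => F (A ω) ω)
    (hBm : ∀ i, μ⟦B ⁻¹' {i} | m'⟧ =ᵐ[μ] μ⟦B ⁻¹' {i} | m⟧)
    (hFm : ∀ i, μ[F i | m'] =ᵐ[μ] μ[F i | m])
    (hBFm : ∀ i j, μ[eqIndicator B i * F j | m'] =ᵐ[μ] μ[eqIndicator B i * F j | m])
    (hL : ∀ i, ∀ᵐ ω ∂μ, (fun j => condCov m μ (eqIndicator B i) (F j) ω) ∈ L) :
    ∀ᵐ ω ∂μ, (μ[fun ω => F (B ω) ω - F (A ω) ω | m]) ω ^ 2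
      ≤ Module.finrank ℝ L / 2 * ((b - a) ^ 2 * ∑ i, entropyGain m G μ (eqIndicator B i) ω) := by
  have hx : ∀ i, AEStronglyMeasurable (eqIndicator B i) μ := fun i =>
    (stronglyMeasurable_eqIndicator hB i).aestronglyMeasurable
  have hx01 : ∀ i, ∀ᵐ ω ∂μ, eqIndicator B i ω ∈ Set.Icc (0 : ℝ) 1 := fun i =>
    ae_of_all _ (eqIndicator_mem_Icc B i)
  have hregret := condExp_apply_sub_apply_eq_sum_condCov hmm' (hm'G.trans hG) hA hB
    (fun i => .of_mem_Icc a b (hF i).aemeasurable (hFab i)) hFm hAB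
  have hα : ∀ i, 0 ≤ᵐ[μ] μ⟦B ⁻¹' {i} | m⟧ := fun i =>
    condExp_nonneg ((hx01 i).mono fun _ h => h.1)
  filter_upwards [hregret, ae_all_iff.2 hL, ae_all_iff.2 hα, ae_all_iff.2 hAB,
    ae_all_iff.2 fun i => entropyGain_nonneg (hmm'.trans hm'G) hG (hx i) (hx01 i),
    ae_all_iff.2 fun i => condCov_eq_zero_of_condExp_eq_zero (hmm'.trans (hm'G.trans hG)) (hx i)
      (hx01 i) (hF i) (hFab i),
    ae_all_iff.2 fun i => two_mul_sum_condExp_mul_sq_condCov_le hmm' hm'G hG (hx i) (hx01 i) hA hF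
      hFab hFA (hBm i) hFm (hBFm i)] with ω hregret hL hα hAB hg hdiag hrow
  simp only [hAB] at hrow
  rw [hregret, Finset.sum_apply, Finset.mul_sum]
  refine sq_trace_le_finrank_div_two_mul_sum L
    (N := Matrix.of fun j i => condCov m μ (eqIndicator B i) (F j) ω) hL hα
    (fun i => mul_nonneg (sq_nonneg _) (hg i)) hdiag fun i => (hrow i).trans_eq ?_
  ring

end PosteriorSampling

namespace OnlineProblem

variable {Ω : Type*} [MeasurableSpace Ω] {μ : Measure Ω}
  {𝒜 𝒴 𝒰 : Type*} [MeasurableSpace 𝒜] [MeasurableSpace 𝒴] [MeasurableSpace 𝒰]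
  (P : OnlineProblem μ 𝒜 𝒴 𝒰)

lemma infoRatio_le_ofReal [Fintype 𝒜] {t : ℕ} {γ : ℝ} {ω : Ω} (hγ : 0 ≤ γ)
    (h : (μ[P.regretAt t | P.hist t]) ω ^ 2 ≤ γ * P.infoGain t ω) :
    P.infoRatio t ω ≤ ENNReal.ofReal γ :=
  ENNReal.div_le_of_le_mul <| ENNReal.ofReal_mul hγ ▸ ENNReal.ofReal_le_ofReal h

/-- The `σ`-algebra of the history before period `t` together with the action `A_t`. -/
abbrev histWithAction (t : ℕ) : MeasurableSpace Ω :=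
  P.hist t ⊔ MeasurableSpace.comap (P.A t) inferInstance

lemma histWithAction_le_hist_sup_comap_U (t : ℕ) :
    P.histWithAction t ≤ P.hist t ⊔ MeasurableSpace.comap (P.U t) inferInstance :=
  sup_le le_sup_left (P.measurable_A t).comap_le

lemma histWithAction_le_hist_succ (t : ℕ) : P.histWithAction t ≤ P.hist (t + 1) :=
  sup_le (P.hist_mono t.le_succ) (measurable_fst.comp (P.measurable_observation t)).comap_le

lemma measurable_reward_A (t : ℕ) :
    Measurable[P.hist (t + 1)] fun ω => P.reward t (P.A t ω) ω :=
  P.measurable_R.comp (measurable_snd.comp (P.measurable_observation t))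

variable [MeasurableSingletonClass 𝒜] [IsProbabilityMeasure μ]

lemma condExp_histWithAction_eq [Countable 𝒜] (t : ℕ) {W : Ω → ℝ}
    (hW : StronglyMeasurable[P.sigmaWithout t] W) (hWi : Integrable W μ) :
    μ[W | P.histWithAction t] =ᵐ[μ] μ[W | P.hist t] :=
  condExp_eq_of_le_sup_of_indep le_sup_left (P.histWithAction_le_hist_sup_comap_U t)
    (P.hist_le_sigmaWithout t) (P.sigmaWithout_le t) (P.measurable_U t).comap_le (P.indep_U t)
    hW hWi

lemma condCov_reward_mem_submodule [Finite 𝒜] {L : Submodule ℝ (𝒜 → ℝ)}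
    (hR : P.RewardRangeLeOne) (hL : ∀ p ∈ P.family, P.meanReward p ∈ L) (t : ℕ) (a : 𝒜) :
    ∀ᵐ ω ∂μ, (fun b => condCov (P.hist t) μ (eqIndicator P.Astar a) (P.reward t b) ω) ∈ L := by
  have hle := (P.sigmaPast_le_sigmaWithout t le_rfl).trans (P.sigmaWithout_le t)
  refine condCov_mem_submodule_of_condExp_mem (P.hist_le_sigmaPast t) hle
    (memLp_top_eqIndicator P.measurable_Astar_ambient a)
    ((stronglyMeasurable_eqIndicator P.measurable_Astar a).mono (P.sigmaPstar_le_sigmaPast t t))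
    (integrable_reward hR t) ?_
  filter_upwards [ae_all_iff.2 (condExp_reward_sigmaPast hR t t)] with ω hω
  rw [funext hω]
  exact hL _ (P.pstar_mem ω)

variable [Fintype 𝒜]

lemma infoGain_eq_sum_entropyGain (t : ℕ) :
    P.infoGain t
      =ᵐ[μ] ∑ a, entropyGain (P.hist t) (P.hist (t + 1)) μ (eqIndicator P.Astar a) := by
  rw [hist_succ]
  exact postMutualInfo_eq_sum_entropyGain (P.hist_le t)
    ((P.measurable_observation t).mono (P.hist_le (t + 1)) le_rfl)
    P.measurable_Astar_ambient

lemma infoGain_nonneg (t : ℕ) : 0 ≤ᵐ[μ] P.infoGain t := by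
  filter_upwards [P.infoGain_eq_sum_entropyGain t, ae_all_iff.2 fun a =>
    entropyGain_nonneg (μ := μ) (P.hist_mono t.le_succ) (P.hist_le (t + 1))
      (stronglyMeasurable_eqIndicator P.measurable_Astar_ambient a).aestronglyMeasurable
      (ae_of_all _ (eqIndicator_mem_Icc P.Astar a))] with ω hsum hgain
  rw [hsum, Finset.sum_apply]
  exact Finset.sum_nonneg fun a _ => hgain a

lemma sq_condExp_regretAt_le {L : Submodule ℝ (𝒜 → ℝ)} (hR : P.RewardRangeLeOne)
    (hTS : P.IsThompson) (hL : ∀ p ∈ P.family, P.meanReward p ∈ L) (t : ℕ) :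
    ∀ᵐ ω ∂μ, (μ[P.regretAt t | P.hist t]) ω ^ 2 ≤ Module.finrank ℝ L / 2 * P.infoGain t ω := by
  obtain ⟨c, hc⟩ := hR.exists_forall_mem_Icc
  have hopt : ∀ a, StronglyMeasurable[P.sigmaWithout t] (eqIndicator P.Astar a) := fun a =>
    (stronglyMeasurable_eqIndicator P.measurable_Astar a).mono le_sup_right
  have hoptLp : ∀ a, MemLp (eqIndicator P.Astar a) ⊤ μ :=
    memLp_top_eqIndicator P.measurable_Astar_ambient
  have hrew : ∀ a, StronglyMeasurable[P.sigmaWithout t] (P.reward t a) := fun a =>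
    ((P.measurable_reward t a).mono (P.comap_Y_le_sigmaWithout t t) le_rfl).stronglyMeasurable
  filter_upwards [sq_condExp_apply_sub_apply_le L le_sup_left (P.histWithAction_le_hist_succ t)
    (P.hist_le (t + 1)) ((comap_measurable (P.A t)).mono le_sup_right le_rfl)
    P.measurable_Astar_ambient (hTS t)
    (fun a => ((hrew a).mono (P.sigmaWithout_le t)).aestronglyMeasurable)
    (fun a => ae_of_all _ fun ω => hc (P.Y t ω a)) (P.measurable_reward_A t).stronglyMeasurable
    (fun a => P.condExp_histWithAction_eq t (hopt a) ((hoptLp a).integrable le_top))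
    (fun a => P.condExp_histWithAction_eq t (hrew a) (integrable_reward hR t a))
    (fun a b => P.condExp_histWithAction_eq t ((hopt a).mul (hrew b))
      ((integrable_reward hR t b).mul_of_top_right (hoptLp a)))
    (P.condCov_reward_mem_submodule hR hL t), P.infoGain_eq_sum_entropyGain t] with ω hle hgain
  rw [hgain, Finset.sum_apply]
  rwa [add_sub_cancel_left, one_pow, one_mul] at hle

end OnlineProblem

section Regret

lemma sq_integral_le_integral_of_sq_le {Ω : Type*} [MeasurableSpace Ω] {μ : Measure Ω}
    [IsProbabilityMeasure μ] {X Y : Ω → ℝ} (hX : Integrable X μ) (hY : Integrable Y μ)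
    (hXY : ∀ᵐ ω ∂μ, X ω ^ 2 ≤ Y ω) : (∫ ω, X ω ∂μ) ^ 2 ≤ ∫ ω, Y ω ∂μ := by
  have hX2 : Integrable (fun ω => X ω ^ 2) μ := hY.mono' (hX.aestronglyMeasurable.pow 2)
    (hXY.mono fun ω h => by rwa [Real.norm_eq_abs, abs_sq])
  calc (∫ ω, X ω ∂μ) ^ 2 ≤ ∫ ω, X ω ^ 2 ∂μ :=
        (even_two.convexOn_pow (𝕜 := ℝ)).map_integral_le (continuous_pow 2).continuousOn
          isClosed_univ (ae_of_all _ fun _ => Set.mem_univ _) hX hX2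
    _ ≤ ∫ ω, Y ω ∂μ := integral_mono_ae hX2 hY hXY

end Regret

namespace OnlineProblem

variable {Ω : Type*} [MeasurableSpace Ω] {μ : Measure Ω}
  {𝒜 𝒴 𝒰 : Type*} [MeasurableSpace 𝒜] [MeasurableSpace 𝒴] [MeasurableSpace 𝒰]
  (P : OnlineProblem μ 𝒜 𝒴 𝒰)

lemma integrable_regretAt [Finite 𝒜] [MeasurableSingletonClass 𝒜] [IsFiniteMeasure μ]
    (hR : P.RewardRangeLeOne) (t : ℕ) : Integrable (P.regretAt t) μ := by
  have hA : Measurable (P.A t) :=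
    measurable_fst.comp ((P.measurable_observation t).mono (P.hist_le (t + 1)) le_rfl)
  exact (integrable_apply_of_finite P.measurable_Astar_ambient (integrable_reward hR t)).sub
    (integrable_apply_of_finite hA (integrable_reward hR t))

variable [Fintype 𝒜]

lemma infoGain_eq_postEntropy_sub (t : ℕ) :
    P.infoGain t = postEntropy (P.hist t) μ P.Astar
      - μ[postEntropy (P.hist (t + 1)) μ P.Astar | P.hist t] := by
  rw [hist_succ]
  rfl

variable [MeasurableSingletonClass 𝒜] [IsProbabilityMeasure μ]

lemma integrable_postEntropy (t : ℕ) : Integrable (postEntropy (P.hist t) μ P.Astar) μ :=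
  integrable_finsetSum _ fun a _ => integrable_negMulLog_condExp (P.hist_le t)
    (stronglyMeasurable_eqIndicator P.measurable_Astar_ambient a).aestronglyMeasurable
    (ae_of_all _ (eqIndicator_mem_Icc P.Astar a))

lemma integrable_infoGain (t : ℕ) : Integrable (P.infoGain t) μ := by
  rw [P.infoGain_eq_postEntropy_sub]
  exact (P.integrable_postEntropy t).sub integrable_condExp

lemma integral_infoGain (t : ℕ) :
    ∫ ω, P.infoGain t ω ∂μ = ∫ ω, postEntropy (P.hist t) μ P.Astar ω ∂μ
      - ∫ ω, postEntropy (P.hist (t + 1)) μ P.Astar ω ∂μ := by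
  rw [P.infoGain_eq_postEntropy_sub, integral_sub' (P.integrable_postEntropy t) integrable_condExp,
    integral_condExp (P.hist_le t)]

lemma postEntropy_hist_zero : postEntropy (P.hist 0) μ P.Astar = fun _ => entropy μ P.Astar := by
  have hbot : P.hist 0 = ⊥ := by simp [hist, history]
  ext ω
  refine Finset.sum_congr rfl fun a _ => ?_
  rw [hbot, condExp_bot, integral_indicator_const _
    (P.measurable_Astar_ambient (measurableSet_singleton a)), smul_eq_mul, mul_one]

lemma postEntropy_hist_nonneg (t : ℕ) : 0 ≤ᵐ[μ] postEntropy (P.hist t) μ P.Astar := by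
  have hprob : ∀ a, ∀ᵐ ω ∂μ, (μ⟦P.Astar ⁻¹' {a} | P.hist t⟧) ω ∈ Set.Icc (0 : ℝ) 1 := fun a =>
    (convex_Icc 0 1).condExp_mem (P.hist_le t)
      ((memLp_top_eqIndicator P.measurable_Astar_ambient a).integrable le_top) isClosed_Icc
      (ae_of_all _ (eqIndicator_mem_Icc P.Astar a))
  filter_upwards [ae_all_iff.2 hprob] with ω hω
  exact Finset.sum_nonneg fun a _ => Real.negMulLog_nonneg (hω a).1 (hω a).2

lemma sum_integral_infoGain_le_entropy (T : ℕ) :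
    ∑ t ∈ Finset.range T, ∫ ω, P.infoGain t ω ∂μ ≤ entropy μ P.Astar := by
  simp only [integral_infoGain]
  rw [Finset.sum_range_sub' fun t => ∫ ω, postEntropy (P.hist t) μ P.Astar ω ∂μ,
    postEntropy_hist_zero, integral_const, probReal_univ, one_smul]
  exact sub_le_self _ (integral_nonneg_of_ae (P.postEntropy_hist_nonneg T))

lemma integral_regret_le (hR : P.RewardRangeLeOne) {γ : ℝ} (hγ : 0 ≤ γ)
    (hle : ∀ t, ∀ᵐ ω ∂μ, (μ[P.regretAt t | P.hist t]) ω ^ 2 ≤ γ * P.infoGain t ω) (T : ℕ) :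
    ∫ ω, P.regret T ω ∂μ ≤ √(γ * entropy μ P.Astar * T) := by
  have hsq : ∀ t, (∫ ω, P.regretAt t ω ∂μ) ^ 2 ≤ γ * ∫ ω, P.infoGain t ω ∂μ := fun t => by
    rw [← integral_condExp (P.hist_le t), ← integral_const_mul]
    exact sq_integral_le_integral_of_sq_le integrable_condExp
      ((P.integrable_infoGain t).const_mul γ) (hle t)
  have hsum : ∫ ω, P.regret T ω ∂μ = ∑ t ∈ Finset.range T, ∫ ω, P.regretAt t ω ∂μ :=
    integral_finsetSum _ fun t _ => P.integrable_regretAt hR t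
  rw [hsum]
  refine Real.le_sqrt_of_sq_le ?_
  calc (∑ t ∈ Finset.range T, ∫ ω, P.regretAt t ω ∂μ) ^ 2
      ≤ T * ∑ t ∈ Finset.range T, (∫ ω, P.regretAt t ω ∂μ) ^ 2 := by
        simpa only [Finset.card_range] using
          sq_sum_le_card_mul_sum_sq (s := Finset.range T) (f := fun t => ∫ ω, P.regretAt t ω ∂μ)
    _ ≤ T * ∑ t ∈ Finset.range T, γ * ∫ ω, P.infoGain t ω ∂μ := by
        gcongr with t
        exact hsq t
    _ ≤ T * (γ * entropy μ P.Astar) := by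
        rw [← Finset.mul_sum]
        gcongr
        exact P.sum_integral_infoGain_le_entropy T
    _ = γ * entropy μ P.Astar * T := mul_comm _ _

end OnlineProblem

end ThompsonSampling

theorem proposition5_general {Ω : Type*} [MeasurableSpace Ω] (μ : Measure Ω)
    [IsProbabilityMeasure μ] {𝒜 𝒴 𝒰 : Type*} [Fintype 𝒜] [MeasurableSpace 𝒜]
    [MeasurableSingletonClass 𝒜] [MeasurableSpace 𝒴] [MeasurableSpace 𝒰] (d : ℕ)
    (P : ThompsonSampling.OnlineProblem μ 𝒜 𝒴 𝒰) (hR : P.RewardRangeLeOne) (hTS : P.IsThompson)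
    (L : Submodule ℝ (𝒜 → ℝ)) (hd : Module.finrank ℝ L ≤ d)
    (hL : ∀ p ∈ P.family, P.meanReward p ∈ L) :
    (∀ t : ℕ, ∀ᵐ ω ∂μ, P.infoRatio t ω ≤ (d : ℝ≥0∞) / 2) ∧
    (∀ T : ℕ, ∫ ω, P.regret T ω ∂μ
      ≤ √(ThompsonSampling.entropy μ P.Astar * d * T / 2)) := by
  have hsq : ∀ t, ∀ᵐ ω ∂μ, (μ[P.regretAt t | P.hist t]) ω ^ 2 ≤ d / 2 * P.infoGain t ω :=
      fun t => by
    filter_upwards [P.sq_condExp_regretAt_le hR hTS hL t, P.infoGain_nonneg t] with ω hle hgain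
    exact hle.trans (mul_le_mul_of_nonneg_right (by gcongr) hgain)
  refine ⟨fun t => (hsq t).mono fun ω hω => ?_, fun T => ?_⟩
  · have h := P.infoRatio_le_ofReal (by positivity) hω
    rwa [ENNReal.ofReal_div_of_pos two_pos, ENNReal.ofReal_natCast, ENNReal.ofReal_ofNat] at h
  · refine (P.integral_regret_le hR (by positivity) hsq T).trans_eq ?_
    congr 1
    ring

theorem proposition5 {Ω : Type*} [MeasurableSpace Ω] (μ : Measure Ω) [IsProbabilityMeasure μ]
    {𝒴 𝒰 : Type*} [MeasurableSpace 𝒴] [MeasurableSpace 𝒰]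
    (d : ℕ) (𝒜 : Finset (EuclideanSpace ℝ (Fin d)))
    (P : ThompsonSampling.OnlineProblem μ 𝒜 𝒴 𝒰)
    (hR : P.RewardRangeLeOne)
    (hTS : P.IsThompson)
    (hlin : ∀ p ∈ P.family, ∃ θ : EuclideanSpace ℝ (Fin d), ∀ a : 𝒜,
      ∫ y, P.R y ∂(ThompsonSampling.marginal p a)
        = inner ℝ (a : EuclideanSpace ℝ (Fin d)) θ) :
    (∀ t : ℕ, ∀ᵐ ω ∂μ, P.infoRatio t ω ≤ (d : ℝ≥0∞) / 2) ∧
    (∀ T : ℕ, ∫ ω, P.regret T ω ∂μ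
      ≤ Real.sqrt (ThompsonSampling.entropy μ P.Astar * d * T / 2)) :=
  let S : EuclideanSpace ℝ (Fin d) →ₗ[ℝ] (𝒜 → ℝ) :=
    LinearMap.pi fun a => innerₗ _ (a : EuclideanSpace ℝ (Fin d))
  have hrank : Module.finrank ℝ (LinearMap.range S) ≤ d := by
    simpa using LinearMap.finrank_range_le S
  proposition5_general μ d P hR hTS (LinearMap.range S) hrank
    fun p hp => (hlin p hp).imp fun θ hθ => funext fun a => (hθ a).symm
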